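/- Let $G$ be a linear (real) Lie group, i.e. a topological group isomorphic to a closed subgroup of $GL_n(\mathbb R)$ for some $n$. Let $A$ be a compact normal subgroup of $G$ and let $\rho\colon A\to U(V_\rho)$ be an irreducible unitary (continuous, finite-dimensional, complex) representation. The group $G$ acts on unitary equivalence classes of irreducible representations of $A$ by $(g\cdot\rho)(a)=\rho(g^{-1}ag)$; let $G_{[\rho]}$ be the isotropy group of the class $[\rho]$ and $Q_{[\rho]}=G_{[\rho]}/A$. Let $p\colon U(V_\rho)\to PU(V_\rho)=\mathrm{Inn}(U(V_\rho))$ be the projection sending $u$ to conjugation by $u$, and let $\Upsilon\colon G_{[\rho]}\to PU(V_\rho)$ be the homomorphism $\Upsilon(g)=p(U_g)$, where $U_g\in U(V_\rho)$ is any unitary with $\rho(g^{-1}ag)=U_g^{-1}\rho(a)U_g$ for all $a\in A$. Put $$\widetilde G_{[\rho]}=\{(g,u)\in G_{[\rho]}\times U(V_\rho)\mid \Upsilon(g)=p(u)\},\qquad \widetilde Q_{[\rho]}=\widetilde G_{[\rho]}/\{(a,\rho(a))\mid a\in A\},$$ so that $\widetilde Q_{[\rho]}$ is the middle term of the central extension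 $1\to S^1\to\widetilde Q_{[\rho]}\to Q_{[\rho]}\to 1$. Then $\widetilde Q_{[\rho]}$ satisfies (AN), where a topological group $H$ is said to satisfy (AN) if the following holds: for every locally compact Hausdorff space $X$ with a proper $H$-action such that the orbit space $X/H$ is compact, and every finite-dimensional complex $H$-vector bundle $E\to X$, there exist a finite-dimensional complex $H$-representation $V$ and a finite-dimensional complex $H$-vector bundle $F\to X$ such that $E\oplus F\cong X\times V$ as $H$-vector bundles over $X$. -/

import Mathlib

universe u v w

/-! ### Irreducible unitary representations and the group `G_[ρ]` -/

section Mackey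

variable {G : Type*} [Group G] [TopologicalSpace G] [IsTopologicalGroup G]
variable {V : Type*} [NormedAddCommGroup V] [InnerProductSpace ℂ V] [CompleteSpace V]

/-- The unitary group `U(V)` of a finite-dimensional Hilbert space, with its norm topology. -/
noncomputable abbrev UGroup (V : Type*) [NormedAddCommGroup V] [InnerProductSpace ℂ V] [CompleteSpace V] :=
  unitary (V →L[ℂ] V)

/-- An irreducible (continuous) unitary representation of `A` on `V`. -/
@[ext] structure IrrUnitaryRep (A : Type*) [Group A] [TopologicalSpace A]
    (V : Type*) [NormedAddCommGroup V] [InnerProductSpace ℂ V] [CompleteSpace V] where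
  hom : A →* UGroup V
  continuous_hom : Continuous hom
  nontrivial : Nontrivial V
  irreducible : ∀ W : Submodule ℂ V,
    (∀ a : A, ∀ w ∈ W, (hom a : V →L[ℂ] V) w ∈ W) → W = ⊥ ∨ W = ⊤

/-- Unitary equivalence of irreducible representations on `V`: `σ(a) = U⁻¹ ρ(a) U`. -/
instance IrrUnitaryRep.setoid (A : Type*) [Group A] [TopologicalSpace A]
    (V : Type*) [NormedAddCommGroup V] [InnerProductSpace ℂ V] [CompleteSpace V] :
    Setoid (IrrUnitaryRep A V) where
  r σ ρ := ∃ U : UGroup V, ∀ a, σ.hom a = U⁻¹ * ρ.hom a * U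
  iseqv :=
    { refl := fun ρ => ⟨1, fun a => by simp⟩
      symm := by
        rintro σ ρ ⟨U, hU⟩
        exact ⟨U⁻¹, fun a => by rw [hU]; group⟩
      trans := by
        rintro σ ρ τ ⟨U, hU⟩ ⟨W, hW⟩
        exact ⟨W * U, fun a => by rw [hU, hW]; group⟩ }

/-- The classes in `Irr(A)` of those irreducible representations whose underlying space is `V`. -/
abbrev IrrClass (A : Type*) [Group A] [TopologicalSpace A]
    (V : Type*) [NormedAddCommGroup V] [InnerProductSpace ℂ V] [CompleteSpace V] :=
  Quotient (IrrUnitaryRep.setoid A V)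

variable (A : Subgroup G) [A.Normal]

/-- The representation `g · ρ`, `(g · ρ)(a) = ρ(g⁻¹ a g)`. -/
noncomputable def IrrUnitaryRep.conj (g : G) (ρ : IrrUnitaryRep A V) : IrrUnitaryRep A V where
  hom := ρ.hom.comp (MulAut.conjNormal g⁻¹ : MulAut A).toMonoidHom
  continuous_hom := by
    refine ρ.continuous_hom.comp (continuous_induced_rng.2 ?_)
    have : (Subtype.val ∘ ⇑((MulAut.conjNormal g⁻¹ : MulAut A).toMonoidHom))
        = fun a : A => g⁻¹ * (a : G) * g := by
      funext a; simp
    rw [this]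
    fun_prop
  nontrivial := ρ.nontrivial
  irreducible := fun W hW => ρ.irreducible W fun a w hw => by
    have := hW ((MulAut.conjNormal g⁻¹ : MulAut A).symm a) w hw
    simpa using this

/-- The left action of `G` on classes of irreducible representations of `A`. -/
noncomputable instance IrrClass.mulAction : MulAction G (IrrClass A V) where
  smul g := Quotient.map (IrrUnitaryRep.conj A g) (by
    rintro σ ρ ⟨U, hU⟩
    exact ⟨U, fun a => hU _⟩)
  one_smul := by
    rintro ⟨ρ⟩
    refine congrArg (Quotient.mk _) (IrrUnitaryRep.ext ?_)
    ext1 a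
    simp [IrrUnitaryRep.conj]
  mul_smul := by
    rintro g h ⟨ρ⟩
    refine congrArg (Quotient.mk _) (IrrUnitaryRep.ext ?_)
    ext1 a
    simp [IrrUnitaryRep.conj]

variable {A}

namespace IrrUnitaryRep

/-- `G_[ρ]`, the isotropy group of the class `[ρ]`. -/
noncomputable def isotropy (ρ : IrrUnitaryRep A V) : Subgroup G :=
  MulAction.stabilizer G (Quotient.mk _ ρ : IrrClass A V)

theorem mem_isotropy_iff (ρ : IrrUnitaryRep A V) (g : G) :
    g ∈ ρ.isotropy ↔ ∃ U : UGroup V, ∀ a : A,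
      ρ.hom (MulAut.conjNormal g⁻¹ a) = U⁻¹ * ρ.hom a * U :=
  MulAction.mem_stabilizer_iff.trans Quotient.eq

/-- `A ⊆ G_[ρ]`. -/
theorem le_isotropy (ρ : IrrUnitaryRep A V) : A ≤ ρ.isotropy := by
  intro x hx
  rw [mem_isotropy_iff]
  refine ⟨ρ.hom ⟨x, hx⟩, fun a => ?_⟩
  rw [← map_inv, ← map_mul, ← map_mul]
  congr 1
  ext
  simp

end IrrUnitaryRep

/-- `PU(V) = Inn(U(V))`. -/
noncomputable abbrev PUGroup (V : Type*) [NormedAddCommGroup V] [InnerProductSpace ℂ V] [CompleteSpace V] :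
    Type _ :=
  (MulAut.conj : UGroup V →* MulAut (UGroup V)).range

/-- The projection `p : U(V) → PU(V)`; `p u` is conjugation by `u`. -/
noncomputable def puProj (V : Type*) [NormedAddCommGroup V] [InnerProductSpace ℂ V] [CompleteSpace V] :
    UGroup V →* PUGroup V :=
  (MulAut.conj : UGroup V →* MulAut (UGroup V)).rangeRestrict

theorem puProj_eq_iff (u w : UGroup V) :
    puProj V u = puProj V w ↔ ∀ x : UGroup V, u * x * u⁻¹ = w * x * w⁻¹ := by
  rw [Subtype.ext_iff, MulEquiv.ext_iff]
  rfl

namespace IrrUnitaryRep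

variable [FiniteDimensional ℂ V]

/-- Schur's lemma: a unitary commuting with an irreducible representation is scalar. -/
theorem exists_scalar (ρ : IrrUnitaryRep A V) (T : UGroup V)
    (hT : ∀ a, T * ρ.hom a = ρ.hom a * T) :
    ∃ c : ℂ, ∀ v : V, (T : V →L[ℂ] V) v = c • v := by
  have := ρ.nontrivial
  obtain ⟨c, hc⟩ := Module.End.exists_eigenvalue ((T : V →L[ℂ] V) : V →ₗ[ℂ] V)
  refine ⟨c, fun v => ?_⟩
  have hW := ρ.irreducible (Module.End.eigenspace ((T : V →L[ℂ] V) : V →ₗ[ℂ] V) c) (by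
    intro a w hw
    rw [Module.End.mem_eigenspace_iff] at hw ⊢
    have h1 := congrArg (fun S : UGroup V => (S : V →L[ℂ] V) w) (hT a)
    simp only [Submonoid.coe_mul, mul_apply_eq_comp] at h1
    have hw' : (T : V →L[ℂ] V) w = c • w := hw
    rw [hw', map_smul] at h1
    exact h1)
  rcases hW with h | h
  · exact absurd h hc
  · have : v ∈ Module.End.eigenspace ((T : V →L[ℂ] V) : V →ₗ[ℂ] V) c := by rw [h]; trivial
    exact Module.End.mem_eigenspace_iff.1 this

/-- The class in `PU(V)` of an intertwining unitary does not depend on its choice. -/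
theorem puProj_eq_of_intertwines (ρ : IrrUnitaryRep A V) (U W : UGroup V)
    (h : ∀ a, U⁻¹ * ρ.hom a * U = W⁻¹ * ρ.hom a * W) : puProj V U = puProj V W := by
  obtain ⟨c, hc⟩ := ρ.exists_scalar (W * U⁻¹) (fun a => by
    have := h a
    calc W * U⁻¹ * ρ.hom a = W * (U⁻¹ * ρ.hom a * U) * U⁻¹ := by group
      _ = _ := by rw [this]; group)
  have hcomm : ∀ x : UGroup V, (W * U⁻¹) * x = x * (W * U⁻¹) := by
    intro x
    apply Subtype.ext
    ext v
    have h1 : ((W * U⁻¹ * x : UGroup V) : V →L[ℂ] V) v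
        = ((W * U⁻¹ : UGroup V) : V →L[ℂ] V) ((x : V →L[ℂ] V) v) := rfl
    have h2 : ((x * (W * U⁻¹) : UGroup V) : V →L[ℂ] V) v
        = (x : V →L[ℂ] V) (((W * U⁻¹ : UGroup V) : V →L[ℂ] V) v) := rfl
    rw [h1, h2, hc, hc, map_smul]
  rw [puProj_eq_iff]
  intro x
  have := hcomm (U * x * U⁻¹)
  calc U * x * U⁻¹ = (U * x * U⁻¹) * (W * U⁻¹) * (U * W⁻¹) := by group
    _ = (W * U⁻¹) * (U * x * U⁻¹) * (U * W⁻¹) := by rw [this]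
    _ = _ := by group

/-- The homomorphism `Υ : G_[ρ] → PU(V)`, `Υ(g) = p(U_g)` where `U_g` is any unitary with
`ρ(g⁻¹ a g) = U_g⁻¹ ρ(a) U_g` for all `a ∈ A`. -/
noncomputable def upsilon (ρ : IrrUnitaryRep A V) : ρ.isotropy →* PUGroup V :=
  MonoidHom.mk' (fun g => puProj V ((ρ.mem_isotropy_iff g).1 g.2).choose) (by
    intro g h
    have hg := ((ρ.mem_isotropy_iff g).1 g.2).choose_spec
    have hh := ((ρ.mem_isotropy_iff h).1 h.2).choose_spec
    have hgh := ((ρ.mem_isotropy_iff (g * h : ρ.isotropy)).1 (g * h).2).choose_spec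
    rw [← map_mul]
    apply ρ.puProj_eq_of_intertwines
    intro a
    rw [← hgh a]
    simp only [Subgroup.coe_mul, mul_inv_rev, map_mul, MulAut.mul_apply]
    rw [hh, hg]
    group)

theorem upsilon_eq_iff (ρ : IrrUnitaryRep A V) (g : ρ.isotropy) (u : UGroup V) :
    ρ.upsilon g = puProj V u ↔
      ∀ a : A, ρ.hom (MulAut.conjNormal (g : G) a) = u * ρ.hom a * u⁻¹ := by
  have hg := ((ρ.mem_isotropy_iff g).1 g.2).choose_spec
  change puProj V ((ρ.mem_isotropy_iff g).1 g.2).choose = _ ↔ _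
  set U := ((ρ.mem_isotropy_iff g).1 g.2).choose
  have hU : ∀ a : A, ρ.hom (MulAut.conjNormal (g : G) a) = U * ρ.hom a * U⁻¹ := by
    intro a
    have := hg (MulAut.conjNormal (g : G) a)
    rw [← MulAut.mul_apply, ← map_mul, inv_mul_cancel, map_one, MulAut.one_apply] at this
    rw [this]; group
  constructor
  · intro h a
    rw [hU, (puProj_eq_iff U u).1 h]
  · intro h
    apply ρ.puProj_eq_of_intertwines
    intro a
    rw [← hg a]
    have := h (MulAut.conjNormal (g : G)⁻¹ a)
    rw [← MulAut.mul_apply, ← map_mul, mul_inv_cancel, map_one, MulAut.one_apply] at this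
    rw [this]; group

/-- `Υ` extends `p ∘ ρ`. -/
theorem upsilon_of_mem (ρ : IrrUnitaryRep A V) (a : A) :
    ρ.upsilon ⟨a, ρ.le_isotropy a.2⟩ = puProj V (ρ.hom a) := by
  rw [upsilon_eq_iff]
  intro b
  rw [← map_inv, ← map_mul, ← map_mul]
  congr 1

/-! ### The extensions `G̃_[ρ]` and `Q̃_[ρ]` -/

/-- `G̃_[ρ] = G_[ρ] ×_{PU(V)} U(V) = {(g, u) | Υ(g) = p(u)}`, as a subgroup of
`G_[ρ] × U(V)` with the subspace topology. -/
noncomputable def tildeG (ρ : IrrUnitaryRep A V) : Subgroup (ρ.isotropy × UGroup V) :=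
  MonoidHom.eqLocus (ρ.upsilon.comp (MonoidHom.fst _ _)) ((puProj V).comp (MonoidHom.snd _ _))

/-- The homomorphism `ι × ρ : A → G̃_[ρ]`. -/
noncomputable def iotaRho (ρ : IrrUnitaryRep A V) : A →* ρ.tildeG :=
  ((Subgroup.inclusion ρ.le_isotropy).prod ρ.hom).codRestrict ρ.tildeG ρ.upsilon_of_mem

instance iotaRho_range_normal (ρ : IrrUnitaryRep A V) : ρ.iotaRho.range.Normal where
  conj_mem := by
    rintro _ ⟨a, rfl⟩ ⟨⟨g, u⟩, hgu⟩
    refine ⟨MulAut.conjNormal (g : G) a, ?_⟩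
    apply Subtype.ext
    refine Prod.ext ?_ ?_
    · rfl
    · exact (ρ.upsilon_eq_iff g u).1 hgu a

/-- `Q̃_[ρ] = G̃_[ρ] / (ι × ρ)(A)`, with the quotient topology. -/
noncomputable abbrev tildeQ (ρ : IrrUnitaryRep A V) : Type _ := ρ.tildeG ⧸ ρ.iotaRho.range

end IrrUnitaryRep

end Mackey

/-! ### Equivariant complex vector bundles -/

/-- A finite-dimensional complex `G`-vector bundle over the `G`-space `X`. The rank may vary from
one component of `X` to another. -/
structure GVectorBundle (G : Type*) [Group G] [TopologicalSpace G]
    (X : Type u) [TopologicalSpace X] [MulAction G X] where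
  Fiber : X → Type v
  [addCommGroup : ∀ x, AddCommGroup (Fiber x)]
  [module : ∀ x, Module ℂ (Fiber x)]
  /-- the topology of the total space -/
  topology : TopologicalSpace (Σ x, Fiber x)
  continuous_proj : Continuous (fun t : Σ x, Fiber x => t.1)
  locally_trivial : ∀ x₀ : X, ∃ U : Set X, IsOpen U ∧ x₀ ∈ U ∧ ∃ n : ℕ,
    ∃ φ : ∀ x : U, Fiber x ≃ₗ[ℂ] (Fin n → ℂ),
      IsHomeomorph (fun t : {t : Σ x, Fiber x // t.1 ∈ U} =>
        ((⟨t.1.1, t.2⟩, φ ⟨t.1.1, t.2⟩ t.1.2) : U × (Fin n → ℂ)))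
  /-- the action of `g` as a linear map from the fibre at `x` to the fibre at `g • x` -/
  act : ∀ (g : G) (x : X), Fiber x →ₗ[ℂ] Fiber (g • x)
  act_one : ∀ x (e : Fiber x),
    (⟨(1 : G) • x, act 1 x e⟩ : Σ x, Fiber x) = ⟨x, e⟩
  act_mul : ∀ (g h : G) x (e : Fiber x),
    (⟨(g * h) • x, act (g * h) x e⟩ : Σ x, Fiber x) = ⟨g • h • x, act g (h • x) (act h x e)⟩
  continuous_act :
    Continuous (fun p : G × (Σ x, Fiber x) => (⟨p.1 • p.2.1, act p.1 p.2.1 p.2.2⟩ : Σ x, Fiber x))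

namespace GVectorBundle

variable {G : Type*} [Group G] [TopologicalSpace G]
variable {X : Type u} [TopologicalSpace X] [MulAction G X]

attribute [instance] addCommGroup module topology

/-- The total space of a `G`-vector bundle. -/
abbrev Total (E : GVectorBundle.{u, v} G X) : Type (max u v) := Σ x, E.Fiber x

/-- The Whitney sum `E ⊕ F`: its fibres are `E_x × F_x`, its total space is topologised as the
fibre product of the total spaces of `E` and `F` over `X`. -/
def sum (E : GVectorBundle.{u, v} G X) (F : GVectorBundle.{u, w} G X) :
    GVectorBundle.{u, max v w} G X where
  Fiber x := E.Fiber x × F.Fiber x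
  topology := TopologicalSpace.induced
    (fun t => ((⟨t.1, t.2.1⟩, ⟨t.1, t.2.2⟩) : E.Total × F.Total)) inferInstance
  continuous_proj := by
    let tS : TopologicalSpace (Σ x, E.Fiber x × F.Fiber x) := TopologicalSpace.induced
      (fun t => ((⟨t.1, t.2.1⟩, ⟨t.1, t.2.2⟩) : E.Total × F.Total)) inferInstance
    have cS : Continuous (fun t : Σ x, E.Fiber x × F.Fiber x =>
      ((⟨t.1, t.2.1⟩, ⟨t.1, t.2.2⟩) : E.Total × F.Total)) := continuous_induced_dom
    exact E.continuous_proj.comp (continuous_fst.comp cS)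
  locally_trivial := by
    intro x₀
    obtain ⟨U, hU, hxU, n, φ, hφ⟩ := E.locally_trivial x₀
    obtain ⟨W, hW, hxW, m, ψ, hψ⟩ := F.locally_trivial x₀
    let L : ((Fin n → ℂ) × (Fin m → ℂ)) ≃ₗ[ℂ] (Fin (n + m) → ℂ) :=
      (LinearEquiv.sumArrowLequivProdArrow (Fin n) (Fin m) ℂ ℂ).symm.trans
        (LinearEquiv.funCongrLeft ℂ ℂ finSumFinEquiv.symm)
    have hL : Continuous L := LinearMap.continuous_of_finiteDimensional L.toLinearMap
    have hL' : Continuous L.symm := LinearMap.continuous_of_finiteDimensional L.symm.toLinearMap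
    refine ⟨U ∩ W, hU.inter hW, ⟨hxU, hxW⟩, n + m,
      fun x => ((φ ⟨x, x.2.1⟩).prodCongr (ψ ⟨x, x.2.2⟩)).trans L, ?_⟩
    let tS : TopologicalSpace (Σ x, E.Fiber x × F.Fiber x) := TopologicalSpace.induced
      (fun t => ((⟨t.1, t.2.1⟩, ⟨t.1, t.2.2⟩) : E.Total × F.Total))
      inferInstance
    rw [isHomeomorph_iff_exists_inverse] at hφ hψ ⊢
    obtain ⟨cφ, φ', hφl, hφr, cφ'⟩ := hφ
    obtain ⟨cψ, ψ', hψl, hψr, cψ'⟩ := hψ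
    have hφ' : ∀ (x : U) v, φ' (x, v) = ⟨⟨x, (φ x).symm v⟩, x.2⟩ := by
      intro x v
      rw [← hφl ⟨⟨x, (φ x).symm v⟩, x.2⟩]
      simp
    have hψ' : ∀ (x : W) v, ψ' (x, v) = ⟨⟨x, (ψ x).symm v⟩, x.2⟩ := by
      intro x v
      rw [← hψl ⟨⟨x, (ψ x).symm v⟩, x.2⟩]
      simp
    have cS : Continuous (fun t : Σ x, E.Fiber x × F.Fiber x =>
      ((⟨t.1, t.2.1⟩, ⟨t.1, t.2.2⟩) : E.Total × F.Total)) :=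
      continuous_induced_dom
    have cE : Continuous (fun t : {t : Σ x, E.Fiber x × F.Fiber x // t.1 ∈ U ∩ W} =>
        (⟨⟨t.1.1, t.1.2.1⟩, t.2.1⟩ : {t : Σ x, E.Fiber x // t.1 ∈ U})) :=
      Continuous.subtype_mk ((continuous_fst.comp cS).comp continuous_subtype_val) _
    have cF : Continuous (fun t : {t : Σ x, E.Fiber x × F.Fiber x // t.1 ∈ U ∩ W} =>
        (⟨⟨t.1.1, t.1.2.2⟩, t.2.2⟩ : {t : Σ x, F.Fiber x // t.1 ∈ W})) :=
      Continuous.subtype_mk ((continuous_snd.comp cS).comp continuous_subtype_val) _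
    have c1 := cφ.comp cE
    have c2 := cψ.comp cF
    refine ⟨?_, fun q => ⟨⟨q.1, ((φ ⟨q.1, q.1.2.1⟩).symm (L.symm q.2).1,
      (ψ ⟨q.1, q.1.2.2⟩).symm (L.symm q.2).2)⟩, q.1.2⟩, ?_, ?_, ?_⟩
    · refine Continuous.prodMk ?_ ?_
      · exact Continuous.subtype_mk ((continuous_subtype_val.comp continuous_fst).comp c1) _
      · exact hL.comp ((continuous_snd.comp c1).prodMk (continuous_snd.comp c2))
    · intro t
      simp
    · intro q
      simp
    · refine Continuous.subtype_mk (continuous_induced_rng.2 ?_) _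
      refine Continuous.prodMk ?_ ?_
      · have h0 : Continuous (fun q : (U ∩ W : Set X) × (Fin (n + m) → ℂ) =>
            ((⟨q.1, q.1.2.1⟩, (L.symm q.2).1) : U × (Fin n → ℂ))) :=
          Continuous.prodMk (Continuous.subtype_mk (continuous_subtype_val.comp continuous_fst) _)
            (continuous_fst.comp (hL'.comp continuous_snd))
        have := continuous_subtype_val.comp (cφ'.comp h0)
        refine this.congr fun q => ?_
        simp [hφ']
      · have h0 : Continuous (fun q : (U ∩ W : Set X) × (Fin (n + m) → ℂ) =>
            ((⟨q.1, q.1.2.2⟩, (L.symm q.2).2) : W × (Fin m → ℂ))) :=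
          Continuous.prodMk (Continuous.subtype_mk (continuous_subtype_val.comp continuous_fst) _)
            (continuous_snd.comp (hL'.comp continuous_snd))
        have := continuous_subtype_val.comp (cψ'.comp h0)
        refine this.congr fun q => ?_
        simp [hψ']
  act g x := (E.act g x).prodMap (F.act g x)
  act_one := by
    rintro x ⟨e, f⟩
    have h1 := E.act_one x e
    have h2 := F.act_one x f
    rw [Sigma.ext_iff] at h1 h2 ⊢
    refine ⟨h1.1, ?_⟩
    have h3 := h1.2
    have h4 := h2.2
    simp only [LinearMap.prodMap_apply] at h3 h4 ⊢
    generalize E.act 1 x e = e' at *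
    generalize F.act 1 x f = f' at *
    have hx := h1.1
    simp only at hx
    revert e' f'
    rw [hx]
    rintro e' h1 h3 f' h2 h4
    rw [eq_of_heq h3, eq_of_heq h4]
  act_mul := by
    rintro g h x ⟨e, f⟩
    have h1 := E.act_mul g h x e
    have h2 := F.act_mul g h x f
    rw [Sigma.ext_iff] at h1 h2 ⊢
    refine ⟨h1.1, ?_⟩
    have h3 := h1.2
    have h4 := h2.2
    simp only [LinearMap.prodMap_apply] at h3 h4 ⊢
    generalize E.act (g * h) x e = e' at *
    generalize F.act (g * h) x f = f' at *
    have hx := h1.1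
    simp only at hx
    revert e' f'
    rw [hx]
    rintro e' h1 h3 f' h2 h4
    rw [eq_of_heq h3, eq_of_heq h4]
  continuous_act := by
    let tS : TopologicalSpace (Σ x, E.Fiber x × F.Fiber x) := TopologicalSpace.induced
      (fun t => ((⟨t.1, t.2.1⟩, ⟨t.1, t.2.2⟩) : E.Total × F.Total))
      inferInstance
    have cS : Continuous (fun t : Σ x, E.Fiber x × F.Fiber x =>
      ((⟨t.1, t.2.1⟩, ⟨t.1, t.2.2⟩) : E.Total × F.Total)) :=
      continuous_induced_dom
    refine continuous_induced_rng.2 (Continuous.prodMk ?_ ?_)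
    · exact E.continuous_act.comp
        (continuous_fst.prodMk (continuous_fst.comp (cS.comp continuous_snd)))
    · exact F.continuous_act.comp
        (continuous_fst.prodMk (continuous_snd.comp (cS.comp continuous_snd)))

end GVectorBundle

/-- A finite-dimensional (complex, continuous) representation of `G`, on the space `ℂᵐ`. -/
structure ContFDRep (G : Type*) [Group G] [TopologicalSpace G] where
  dim : ℕ
  rep : Representation ℂ G (Fin dim → ℂ)
  continuous_rep : Continuous (fun p : G × (Fin dim → ℂ) => rep p.1 p.2)

namespace GVectorBundle

variable {G : Type*} [Group G] [TopologicalSpace G]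
variable {X : Type u} [TopologicalSpace X] [MulAction G X] [ContinuousSMul G X]

/-- The trivial `G`-vector bundle `X × V` with the diagonal action. -/
noncomputable def trivialBundle (X : Type u) [TopologicalSpace X] [MulAction G X] [ContinuousSMul G X]
    (V : ContFDRep G) : GVectorBundle.{u, 0} G X where
  Fiber _ := Fin V.dim → ℂ
  topology := TopologicalSpace.induced
    (fun t => ((t.1, t.2) : X × (Fin V.dim → ℂ))) inferInstance
  continuous_proj := by
    let tS : TopologicalSpace (Σ _ : X, (Fin V.dim → ℂ)) := TopologicalSpace.induced
      (fun t => ((t.1, t.2) : X × (Fin V.dim → ℂ))) inferInstance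
    have cS : Continuous (fun t : Σ _ : X, (Fin V.dim → ℂ) =>
      ((t.1, t.2) : X × (Fin V.dim → ℂ))) := continuous_induced_dom
    exact continuous_fst.comp cS
  locally_trivial := by
    intro x₀
    refine ⟨Set.univ, isOpen_univ, Set.mem_univ _, V.dim, fun _ => LinearEquiv.refl ℂ _, ?_⟩
    let tS : TopologicalSpace (Σ _ : X, (Fin V.dim → ℂ)) := TopologicalSpace.induced
      (fun t => ((t.1, t.2) : X × (Fin V.dim → ℂ))) inferInstance
    have cS : Continuous (fun t : Σ _ : X, (Fin V.dim → ℂ) =>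
      ((t.1, t.2) : X × (Fin V.dim → ℂ))) := continuous_induced_dom
    rw [isHomeomorph_iff_exists_inverse]
    refine ⟨?_, fun q => ⟨⟨q.1, q.2⟩, q.1.2⟩, fun t => rfl, fun q => rfl, ?_⟩
    · have := cS.comp (continuous_subtype_val
        (p := fun t : Σ _ : X, (Fin V.dim → ℂ) => t.1 ∈ Set.univ))
      exact Continuous.prodMk (Continuous.subtype_mk (continuous_fst.comp this) _)
        (continuous_snd.comp this)
    · refine Continuous.subtype_mk (continuous_induced_rng.2 ?_) _
      exact (continuous_subtype_val.comp continuous_fst).prodMk continuous_snd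
  act g _ := V.rep g
  act_one x e := by simp
  act_mul g h x e := by simp [mul_smul]
  continuous_act := by
    let tS : TopologicalSpace (Σ _ : X, (Fin V.dim → ℂ)) := TopologicalSpace.induced
      (fun t => ((t.1, t.2) : X × (Fin V.dim → ℂ))) inferInstance
    have cS : Continuous (fun t : Σ _ : X, (Fin V.dim → ℂ) =>
      ((t.1, t.2) : X × (Fin V.dim → ℂ))) := continuous_induced_dom
    refine continuous_induced_rng.2 (Continuous.prodMk ?_ ?_)
    · exact continuous_fst.smul (continuous_fst.comp (cS.comp continuous_snd))
    · exact V.continuous_rep.comp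
        (continuous_fst.prodMk (continuous_snd.comp (cS.comp continuous_snd)))

/-- An isomorphism of `G`-vector bundles over `X`. -/
structure Iso (E : GVectorBundle.{u, v} G X) (F : GVectorBundle.{u, w} G X) where
  toFun : ∀ x, E.Fiber x ≃ₗ[ℂ] F.Fiber x
  isHomeomorph : IsHomeomorph (fun t : E.Total => (⟨t.1, toFun t.1 t.2⟩ : F.Total))
  equivariant : ∀ (g : G) x (e : E.Fiber x), toFun (g • x) (E.act g x e) = F.act g x (toFun x e)

end GVectorBundle

/-- Property (AN) of a topological group `G`: every finite-dimensional `G`-vector bundle over a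
proper (locally compact Hausdorff) `G`-space with compact orbit space is a direct summand of a
trivial bundle whose fibre is a finite-dimensional representation of `G`. -/
def SatisfiesAN (G : Type*) [Group G] [TopologicalSpace G] : Prop :=
  ∀ (X : Type u) [TopologicalSpace X] [T2Space X] [LocallyCompactSpace X] [MulAction G X]
    [ProperSMul G X] [CompactSpace (MulAction.orbitRel.Quotient G X)]
    (E : GVectorBundle.{u, v} G X),
    ∃ (V : ContFDRep G) (F : GVectorBundle.{u, 0} G X),
      Nonempty ((E.sum F).Iso (GVectorBundle.trivialBundle X V))

/-- A linear group: a topological group which is (isomorphic, through `f`, to) a closed subgroup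
of `GL_n(ℝ)` for some `n`. -/
def IsLinearGroup (G : Type*) [Group G] [TopologicalSpace G] : Prop :=
  ∃ (n : ℕ) (f : G →* GL (Fin n) ℝ), Topology.IsClosedEmbedding f

/-! The proof isolates one property of a topological group `H`: its representative functions, the
matrix coefficients of finite-dimensional continuous representations, separate points. This property
implies (AN), and `ρ.tildeQ` has it.

It implies (AN) as follows. Let `e ≠ 0` lie in the fibre of `E` over `x`, and let `s` be a compactly
supported fibrewise linear function with `s e ≠ 0`. By properness `m h = s (h⁻¹ e)` has compact
support on `H`. By Stone-Weierstrass some representative function `f` is so close to the conjugate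
of `m` on that support that `∫ m f ≠ 0`. Writing `f h = l (h w)`, the equivariant map `e' ↦ ∫ s (h⁻¹
e') h w dh` into a representation does not kill `e` (`exists_repMap_ne_zero`). Finite direct sums of
such maps are injective on a given fibre. Injectivity is open and invariant along orbits, so
compactness of the orbit space yields a single map `E → X × V` injective on all fibres
(`exists_repMap_injective`). The representation `V` need not be unitarizable, but a cutoff function
on `X` makes it possible to average a Hermitian form into an invariant metric on `X × V` that varies
with the base point (`exists_invariant_metric`). The orthogonal complement of the image is then the
bundle `F` (`exists_complement`).

For `ρ.tildeQ`, the group `ρ.tildeG` sits in the product of a linear group and a unitary group, so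
matrix entries separate its points. Separation passes to the quotient by a compact normal subgroup:
a representative function close to 0 on one coset and to 1 on another is averaged over the subgroup
(`representativeFunctions_separate_quotient`). No matrix embedding of the quotient is needed. -/

/-! ### Finite-dimensional representations -/

namespace ContFDRep

variable {H : Type*} [Group H] [TopologicalSpace H]
variable {V : Type*} [AddCommGroup V] [Module ℂ V] [TopologicalSpace V] [IsTopologicalAddGroup V]
  [ContinuousSMul ℂ V] [T2Space V] [FiniteDimensional ℂ V]

/-- A strongly continuous representation on a finite-dimensional space, written in a basis. -/
noncomputable def ofFiniteDimensional (σ : Representation ℂ H V)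
    (hσ : ∀ v, Continuous fun h => σ h v) : ContFDRep H where
  dim := Module.finrank ℂ V
  rep :=
    { toFun := fun g => (Module.finBasis ℂ V).equivFun.conj (σ g)
      map_one' := by rw [map_one, Module.End.one_eq_id, LinearEquiv.conj_id]; rfl
      map_mul' := fun g h => by
        rw [map_mul, Module.End.mul_eq_comp, LinearEquiv.conj_comp]; rfl }
  continuous_rep := by
    have he : Continuous (Module.finBasis ℂ V).equivFun :=
      LinearMap.continuous_of_finiteDimensional (Module.finBasis ℂ V).equivFun.toLinearMap
    -- Expanding in the basis reduces joint continuity to continuity of the orbit maps of the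
    -- finitely many basis vectors.
    have h : Continuous (fun p : H × (Fin (Module.finrank ℂ V) → ℂ) =>
        ∑ i, p.2 i • (Module.finBasis ℂ V).equivFun (σ p.1 (Module.finBasis ℂ V i))) :=
      continuous_finsetSum _ fun i _ => ((continuous_apply i).comp continuous_snd).smul
        (he.comp ((hσ _).comp continuous_fst))
    refine h.congr fun p => ?_
    change _ = (Module.finBasis ℂ V).equivFun (σ p.1 ((Module.finBasis ℂ V).equivFun.symm p.2))
    rw [Module.Basis.equivFun_symm_apply]
    simp only [map_sum, map_smul]

/-- The identification of the original space with the coordinate space. -/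
noncomputable def ofFiniteDimensionalEquiv (σ : Representation ℂ H V)
    (hσ : ∀ v, Continuous fun h => σ h v) :
    V ≃L[ℂ] (Fin (ofFiniteDimensional σ hσ).dim → ℂ) :=
  (Module.finBasis ℂ V).equivFun.toContinuousLinearEquiv

theorem ofFiniteDimensional_rep (σ : Representation ℂ H V) (hσ : ∀ v, Continuous fun h => σ h v)
    (g : H) (v : V) :
    (ofFiniteDimensional σ hσ).rep g (ofFiniteDimensionalEquiv σ hσ v) =
      ofFiniteDimensionalEquiv σ hσ (σ g v) := by
  change (Module.finBasis ℂ V).equivFun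
    (σ g ((Module.finBasis ℂ V).equivFun.symm ((Module.finBasis ℂ V).equivFun v))) = _
  rw [LinearEquiv.symm_apply_apply]
  rfl

/-- The direct sum of a finite family of representations, as a representation. -/
noncomputable def piRep {ι : Type*} (V : ι → ContFDRep H) :
    Representation ℂ H (∀ i, Fin (V i).dim → ℂ) where
  toFun g := LinearMap.pi fun i => (V i).rep g ∘ₗ LinearMap.proj i
  map_one' := by ext; simp
  map_mul' g h := by
    refine LinearMap.ext fun v => ?_
    funext i
    simp

theorem continuous_piRep {ι : Type*} (V : ι → ContFDRep H) (v : ∀ i, Fin (V i).dim → ℂ) :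
    Continuous fun g => piRep V g v :=
  continuous_pi fun i => (V i).continuous_rep.comp (continuous_id.prodMk continuous_const)

end ContFDRep

/-! ### Representative functions -/

section Representative

variable {H : Type*} [Group H] [TopologicalSpace H]

/-- A continuous function `f` on a group is representative if `(g, h) ↦ f (g * h)` is a finite sum
of products of continuous functions of `g` and `h`. -/
def IsRepresentative (f : C(H, ℂ)) : Prop :=
  ∃ (ι : Type) (_ : Fintype ι) (φ c : ι → C(H, ℂ)), ∀ g h, f (g * h) = ∑ i, φ i g * c i h

/-- The star subalgebra of representative functions. -/
def representativeFunctions (H : Type*) [Group H] [TopologicalSpace H] :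
    StarSubalgebra ℂ C(H, ℂ) where
  carrier := {f | IsRepresentative f}
  mul_mem' := by
    rintro f f' ⟨ι, _, φ, c, h⟩ ⟨ι', _, φ', c', h'⟩
    refine ⟨ι × ι', inferInstance, fun p => φ p.1 * φ' p.2, fun p => c p.1 * c' p.2,
      fun x y => ?_⟩
    simp only [ContinuousMap.mul_apply, h, h', Fintype.sum_mul_sum, Fintype.sum_prod_type]
    exact Finset.sum_congr rfl fun i _ => Finset.sum_congr rfl fun j _ => by ring
  add_mem' := by
    rintro f f' ⟨ι, _, φ, c, h⟩ ⟨ι', _, φ', c', h'⟩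
    refine ⟨ι ⊕ ι', inferInstance, Sum.elim φ φ', Sum.elim c c', fun x y => ?_⟩
    simp [h, h']
  algebraMap_mem' r :=
    ⟨Unit, inferInstance, fun _ => algebraMap ℂ _ r, fun _ => 1, fun x y => by simp⟩
  star_mem' := by
    rintro f ⟨ι, _, φ, c, h⟩
    refine ⟨ι, inferInstance, fun i => star (φ i), fun i => star (c i), fun x y => ?_⟩
    simp [h]

/-- The entries of a continuous matrix representation are representative functions. -/
theorem isRepresentative_entry {n : ℕ} (M : H → Matrix (Fin n) (Fin n) ℂ)
    (hM : ∀ g h, M (g * h) = M g * M h) (hc : Continuous M) (i j : Fin n) :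
    IsRepresentative (⟨fun g => M g i j, hc.matrix_elem i j⟩ : C(H, ℂ)) :=
  ⟨Fin n, inferInstance, fun k => ⟨fun g => M g i k, hc.matrix_elem i k⟩,
    fun k => ⟨fun g => M g k j, hc.matrix_elem k j⟩, fun g h => by
      simp [hM, Matrix.mul_apply]⟩

variable [IsTopologicalGroup H]

/-- Right translation of functions on a group. -/
noncomputable def rightTranslation (H : Type*) [Group H] [TopologicalSpace H]
    [IsTopologicalGroup H] : Representation ℂ H C(H, ℂ) where
  toFun g :=
    { toFun := fun f => f.comp (ContinuousMap.mulRight g)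
      map_add' := fun _ _ => rfl
      map_smul' := fun _ _ => rfl }
  map_one' := by ext; simp
  map_mul' g h := by ext; simp [mul_assoc]

theorem rightTranslation_apply (g h : H) (f : C(H, ℂ)) :
    rightTranslation H g f h = f (h * g) := rfl

/-- The orbit map is the curried form of a continuous function on `H × H`, and currying into the
compact-open topology needs no local compactness. -/
theorem continuous_rightTranslation (f : C(H, ℂ)) :
    Continuous fun g => rightTranslation H g f :=
  (ContinuousMap.curry ⟨fun p : H × H => f (p.2 * p.1), by fun_prop⟩).continuous

/-- A representative function is a matrix coefficient of a finite-dimensional representation. -/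
theorem IsRepresentative.exists_matrixCoefficient {f : C(H, ℂ)} (hf : IsRepresentative f) :
    ∃ (V : ContFDRep H) (w : Fin V.dim → ℂ) (l : (Fin V.dim → ℂ) →L[ℂ] ℂ),
      ∀ h, f h = l (V.rep h w) := by
  obtain ⟨ι, _, φ, c, hφ⟩ := hf
  -- The translates of `f` lie in the span of the `φ i`, so they generate a finite-dimensional
  -- representation. There `f` is the coefficient given by the vector `f` itself and evaluation at
  -- 1.
  let W : Submodule ℂ C(H, ℂ) := Submodule.span ℂ (Set.range fun g => rightTranslation H g f)
  have hW : W ≤ Submodule.span ℂ (Set.range φ) := by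
    rw [Submodule.span_le]
    rintro _ ⟨g, rfl⟩
    have : rightTranslation H g f = ∑ i, c i g • φ i := by
      ext h
      simp [rightTranslation_apply, hφ, ContinuousMap.sum_apply, mul_comm]
    simp only [this]
    exact Submodule.sum_mem _ fun i _ =>
      Submodule.smul_mem _ _ (Submodule.subset_span ⟨i, rfl⟩)
  have : FiniteDimensional ℂ (Submodule.span ℂ (Set.range φ)) :=
    FiniteDimensional.span_of_finite ℂ (Set.finite_range φ)
  have : FiniteDimensional ℂ W := Submodule.finiteDimensional_of_le hW
  have hinv : ∀ g, ∀ w ∈ W, rightTranslation H g w ∈ W := by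
    intro g w hw
    have : W ≤ W.comap (rightTranslation H g) := by
      refine Submodule.span_le.2 ?_
      rintro _ ⟨h, rfl⟩
      refine Submodule.subset_span ⟨g * h, ?_⟩
      simp only [map_mul]
      rfl
    exact this hw
  let σ : Representation ℂ H W :=
    { toFun := fun g => (rightTranslation H g).restrict (hinv g)
      map_one' := by
        refine LinearMap.ext fun w => Subtype.ext ?_
        simp
      map_mul' := fun g h => by
        refine LinearMap.ext fun w => Subtype.ext ?_
        simp }
  have hσ : ∀ v, Continuous fun h => σ h v := fun v =>
    Continuous.subtype_mk (continuous_rightTranslation v.1) _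
  let e := ContFDRep.ofFiniteDimensionalEquiv (V := W) σ hσ
  let ev : W →L[ℂ] ℂ := (ContinuousMap.evalCLM ℂ (1 : H)).comp W.subtypeL
  refine ⟨ContFDRep.ofFiniteDimensional (V := W) σ hσ, e ⟨f, Submodule.subset_span ⟨1, by simp⟩⟩,
    ev.comp e.symm.toContinuousLinearMap, fun h => ?_⟩
  rw [ContFDRep.ofFiniteDimensional_rep (V := W)]
  change f h = ev (e.symm (e _))
  rw [ContinuousLinearEquiv.symm_apply_apply]
  change f h = f (1 * h)
  rw [one_mul]

end Representative

/-! ### Stone-Weierstrass approximation and averaging over a compact normal subgroup -/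

section Averaging

/-- The Stone-Weierstrass theorem on a compact subset. -/
theorem exists_mem_starSubalgebra_near {X : Type*} [TopologicalSpace X]
    (R : StarSubalgebra ℂ C(X, ℂ)) (hR : ∀ x y, x ≠ y → ∃ f ∈ R, f x ≠ f y)
    {K : Set X} (hK : IsCompact K) {φ : X → ℂ} (hφ : ContinuousOn φ K) {ε : ℝ} (hε : 0 < ε) :
    ∃ f ∈ R, ∀ k ∈ K, ‖f k - φ k‖ < ε := by
  have : CompactSpace K := isCompact_iff_compactSpace.1 hK
  let r : C(X, ℂ) →⋆ₐ[ℂ] C(K, ℂ) :=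
    ContinuousMap.compStarAlgHom' ℂ ℂ ⟨Subtype.val, continuous_subtype_val⟩
  have hsep : (R.map r).toSubalgebra.SeparatesPoints := by
    intro x y hxy
    obtain ⟨f, hf, hne⟩ := hR x y (fun h => hxy (Subtype.ext h))
    exact ⟨r f, ⟨r f, ⟨f, hf, rfl⟩, rfl⟩, hne⟩
  have htop := ContinuousMap.starSubalgebra_topologicalClosure_eq_top_of_separatesPoints _ hsep
  have hmem : (⟨K.domRestrict φ, hφ.domRestrict⟩ : C(K, ℂ)) ∈ (R.map r).topologicalClosure := by
    rw [htop]; trivial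
  obtain ⟨_, ⟨f, hf, rfl⟩, hd⟩ := Metric.mem_closure_iff.1 hmem ε hε
  refine ⟨f, hf, fun k hk => ?_⟩
  have := (ContinuousMap.dist_lt_iff hε).1 hd ⟨k, hk⟩
  rwa [dist_comm, dist_eq_norm] at this

open MeasureTheory

variable {H : Type*} [Group H] [TopologicalSpace H] [IsTopologicalGroup H]
variable (N : Subgroup H) [MeasurableSpace N] [BorelSpace N] [CompactSpace N]
  (μ : Measure N) [IsFiniteMeasure μ]

/-- The average of a function over the cosets of a compact subgroup. -/
noncomputable def cosetAverage (f : C(H, ℂ)) : C(H, ℂ) where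
  toFun g := ∫ a : N, f (g * a) ∂μ
  continuous_toFun := by
    rw [← continuousOn_univ]
    refine continuousOn_integral_of_compact_support isCompact_univ (Continuous.continuousOn ?_)
      (fun _ x _ hx => absurd (Set.mem_univ x) hx)
    change Continuous fun p : H × N => f (p.1 * p.2)
    fun_prop

theorem cosetAverage_apply (f : C(H, ℂ)) (g : H) :
    cosetAverage N μ f g = ∫ a : N, f (g * a) ∂μ := rfl

theorem integrable_coset (f : C(H, ℂ)) (g : H) : Integrable (fun a : N => f (g * a)) μ :=
  Continuous.integrable_of_hasCompactSupport (by fun_prop) (HasCompactSupport.of_compactSpace _)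

variable [μ.IsMulLeftInvariant]

theorem cosetAverage_mul_mem (f : C(H, ℂ)) (g : H) (a : N) :
    cosetAverage N μ f (g * a) = cosetAverage N μ f g := by
  have := integral_mul_left_eq_self (μ := μ) (fun b : N => f (g * b)) a
  simpa [cosetAverage_apply, mul_assoc] using this

/-- The average as a function on the quotient. -/
noncomputable def quotientAverage (f : C(H, ℂ)) : C(H ⧸ N, ℂ) where
  toFun := Quotient.lift (cosetAverage N μ f) (by
    intro x y hxy
    rw [← QuotientGroup.leftRel_apply.1 hxy |> fun h => cosetAverage_mul_mem N μ f x ⟨_, h⟩]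
    simp)
  continuous_toFun := (cosetAverage N μ f).continuous.quotient_lift _

theorem quotientAverage_mk (f : C(H, ℂ)) (g : H) :
    quotientAverage N μ f (g : H ⧸ N) = ∫ a : N, f (g * a) ∂μ := rfl

variable [N.Normal] [IsProbabilityMeasure μ]

/-- Averaging `f (x * y * a)` over `a` averages only the factors in `y`. By normality `x * a * y = x
* y * (y⁻¹ * a * y)`, so the result does not change when `x` moves in its coset. A second average,
over that motion, therefore replaces the factors in `x` by their averages as well, and all factors
descend to the quotient. -/
theorem IsRepresentative.quotientAverage {f : C(H, ℂ)} (hf : IsRepresentative f) :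
    IsRepresentative (quotientAverage N μ f) := by
  obtain ⟨ι, _, φ, c, h⟩ := hf
  refine ⟨ι, inferInstance, fun i => _root_.quotientAverage N μ (φ i),
    fun i => _root_.quotientAverage N μ (c i), ?_⟩
  have key : ∀ x y, cosetAverage N μ f (x * y) =
      ∑ i, φ i x * cosetAverage N μ (c i) y := by
    intro x y
    simp only [cosetAverage_apply, mul_assoc, h]
    rw [integral_finsetSum _ fun i _ => (integrable_coset N μ (c i) y).const_mul _]
    simp only [integral_const_mul]
  have key' : ∀ x y, cosetAverage N μ f (x * y) =
      ∑ i, cosetAverage N μ (φ i) x * cosetAverage N μ (c i) y := by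
    intro x y
    have h1 : ∀ a : N, cosetAverage N μ f (x * a * y) = cosetAverage N μ f (x * y) := by
      intro a
      have := cosetAverage_mul_mem N μ f (x * y)
        ⟨y⁻¹ * a * y, by simpa using ‹N.Normal›.conj_mem a a.2 y⁻¹⟩
      rw [← this]
      congr 1
      group
    calc cosetAverage N μ f (x * y) = ∫ a : N, cosetAverage N μ f (x * a * y) ∂μ := by
          simp [h1]
      _ = _ := by
          simp only [key]
          rw [integral_finsetSum _ fun i _ => (integrable_coset N μ (φ i) x).mul_const _]
          simp only [integral_mul_const]
          rfl
  intro x y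
  induction x using QuotientGroup.induction_on with | _ x
  induction y using QuotientGroup.induction_on with | _ y
  exact key' x y

end Averaging

/-- Representative functions separate the points of a quotient by a compact normal subgroup. -/
theorem representativeFunctions_separate_quotient {H : Type*} [Group H] [TopologicalSpace H]
    [IsTopologicalGroup H] [T2Space H] (N : Subgroup H) [N.Normal] (hN : IsCompact (N : Set H))
    (hR : ∀ x y : H, x ≠ y → ∃ f ∈ representativeFunctions H, f x ≠ f y)
    (x y : H ⧸ N) (hxy : x ≠ y) : ∃ f ∈ representativeFunctions (H ⧸ N), f x ≠ f y := by
  induction x using QuotientGroup.induction_on with | _ x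
  induction y using QuotientGroup.induction_on with | _ y
  have : CompactSpace N := isCompact_iff_compactSpace.1 hN
  let _ : MeasurableSpace N := borel N
  have : BorelSpace N := ⟨rfl⟩
  let μ : MeasureTheory.Measure N :=
    MeasureTheory.Measure.haarMeasure ⟨⟨Set.univ, isCompact_univ⟩, by simp⟩
  have : MeasureTheory.IsProbabilityMeasure μ :=
    ⟨MeasureTheory.Measure.haarMeasure_self⟩
  have hx : IsCompact ((x * ·) '' (N : Set H)) := hN.image (by fun_prop)
  have hy : IsCompact ((y * ·) '' (N : Set H)) := hN.image (by fun_prop)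
  have hd : Disjoint ((x * ·) '' (N : Set H)) ((y * ·) '' (N : Set H)) := by
    rw [Set.disjoint_left]
    rintro _ ⟨a, ha, rfl⟩ ⟨b, hb, hab⟩
    apply hxy
    rw [QuotientGroup.eq]
    have : x⁻¹ * y = a * b⁻¹ := by
      rw [inv_mul_eq_iff_eq_mul, ← mul_assoc, eq_mul_inv_iff_mul_eq]
      exact hab
    rw [this]
    exact N.mul_mem ha (N.inv_mem hb)
  -- The two cosets are disjoint and closed, so the indicator of one of them is continuous on their
  -- union and can be approximated there.
  have hφ : ContinuousOn (((y * ·) '' (N : Set H)).indicator (1 : H → ℂ))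
      ((x * ·) '' (N : Set H) ∪ (y * ·) '' (N : Set H)) := by
    refine ContinuousOn.union_of_isClosed ?_ ?_ hx.isClosed hy.isClosed
    · exact (continuousOn_const (c := (0 : ℂ))).congr fun z hz =>
        Set.indicator_of_notMem (Set.disjoint_left.1 hd hz) _
    · exact (continuousOn_const (c := (1 : ℂ))).congr fun z hz =>
        Set.indicator_of_mem hz _
  obtain ⟨f, hf, hfK⟩ := exists_mem_starSubalgebra_near _ hR (hx.union hy) hφ
    (show (0 : ℝ) < 1 / 3 by norm_num)
  refine ⟨quotientAverage N μ f, IsRepresentative.quotientAverage N μ hf, fun heq => ?_⟩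
  -- A probability average of values within 1/3 of `c` stays within 1/3 of `c`. Equal averages on
  -- the two cosets would thus be within 1/3 of both 0 and 1.
  have near : ∀ (z : H) (c : ℂ), (∀ a ∈ N, ‖f (z * a) - c‖ < 1 / 3) →
      ‖quotientAverage N μ f (z : H ⧸ N) - c‖ ≤ 1 / 3 := by
    intro z c h
    have e : quotientAverage N μ f (z : H ⧸ N) - c = ∫ a : N, (f (z * a) - c) ∂μ := by
      rw [MeasureTheory.integral_sub (integrable_coset N μ f z) (MeasureTheory.integrable_const _)]
      simp [quotientAverage_mk]
    rw [e]
    refine (MeasureTheory.norm_integral_le_of_norm_le_const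
      (Filter.Eventually.of_forall fun a : N => (h a a.2).le)).trans ?_
    simp
  have h0 := near x 0 fun a ha => by
    have := hfK (x * a) (Or.inl ⟨a, ha, rfl⟩)
    rwa [Set.indicator_of_notMem (Set.disjoint_left.1 hd ⟨a, ha, rfl⟩)] at this
  have h1 := near y 1 fun a ha => by
    have := hfK (y * a) (Or.inr ⟨a, ha, rfl⟩)
    rwa [Set.indicator_of_mem (Set.mem_image_of_mem (y * ·) ha)] at this
  rw [heq] at h0
  have h2 := norm_sub_le (quotientAverage N μ f (y : H ⧸ N) - 0)
    (quotientAverage N μ f (y : H ⧸ N) - 1)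
  rw [sub_sub_sub_cancel_left, sub_zero, norm_one] at h2
  linarith

/-! ### Integration along a proper action -/

section ProperAction

open MeasureTheory

variable {H : Type*} [Group H] [TopologicalSpace H] [IsTopologicalGroup H]
variable {X : Type*} [TopologicalSpace X] [MulAction H X] [ProperSMul H X]

/-- Properness makes the preimage of `K ×ˢ L` compact, and `C` is the inverse of its projection to
`H`. One `C` serves all points of `L`, which gives local uniformity for integrals over `H`. -/
theorem exists_isCompact_of_inv_smul_mem {K L : Set X} (hK : IsCompact K) (hL : IsCompact L) :
    ∃ C : Set H, IsCompact C ∧ ∀ h : H, ∀ x ∈ L, h⁻¹ • x ∈ K → h ∈ C := by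
  refine ⟨(Prod.fst '' ((fun p : H × X => (p.1 • p.2, p.2)) ⁻¹' (K ×ˢ L)))⁻¹,
    ((ProperSMul.isProperMap_smul_pair.isCompact_preimage (hK.prod hL)).image
      continuous_fst).inv, fun h x hx hK => ?_⟩
  exact ⟨(h⁻¹, x), ⟨hK, hx⟩, rfl⟩

/-- Provides the Haar measure: (AN) does not presuppose that `H` is locally compact, but a proper
action pulls compact neighbourhoods back from `X` along orbit maps. -/
theorem locallyCompactSpace_of_properSMul [LocallyCompactSpace X] [Nonempty X] :
    LocallyCompactSpace H := by
  obtain ⟨x⟩ := ‹Nonempty X›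
  obtain ⟨K, hK, hx⟩ := exists_compact_mem_nhds x
  have : WeaklyLocallyCompactSpace H := by
    refine ⟨fun g => ?_⟩
    obtain ⟨C, hC, hmem⟩ :=
      exists_isCompact_of_inv_smul_mem (H := H) hK (isCompact_singleton (x := g • x))
    refine ⟨C, hC, ?_⟩
    have hc : Continuous fun h : H => h⁻¹ • g • x := by fun_prop
    have : (fun h : H => h⁻¹ • g • x) ⁻¹' K ∈ nhds g :=
      hc.continuousAt.preimage_mem_nhds (by simpa using hx)
    filter_upwards [this] with h hh
    exact hmem h _ rfl hh
  infer_instance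

theorem hasCompactSupport_of_properSMul {F : Type*} [Zero F] {f : H → F} {K : Set X}
    (hK : IsCompact K) (x : X)
    (h0 : ∀ h, h⁻¹ • x ∉ K → f h = 0) : HasCompactSupport f := by
  obtain ⟨C, hC, hmem⟩ :=
      exists_isCompact_of_inv_smul_mem (H := H) hK (isCompact_singleton (x := x))
  exact exists_compact_iff_hasCompactSupport.1
    ⟨C, hC, fun h hh => h0 h fun hk => hh (hmem h _ rfl hk)⟩

/-- Continuity of the integral over the group of a function supported properly over the orbits. -/
theorem continuous_integral_of_properSMul [LocallyCompactSpace X] [MeasurableSpace H]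
    [BorelSpace H] (μ : Measure H) [IsFiniteMeasureOnCompacts μ] {Y : Type*} [TopologicalSpace Y]
    {π : Y → X} (hπ : Continuous π) {F : Type*} [NormedAddCommGroup F] [NormedSpace ℝ F]
    {f : Y → H → F}
    (hf : Continuous f.uncurry) {K : Set X} (hK : IsCompact K)
    (h0 : ∀ y h, h⁻¹ • π y ∉ K → f y h = 0) : Continuous fun y => ∫ h, f y h ∂μ := by
  rw [continuous_iff_continuousAt]
  intro y
  obtain ⟨L, hL, hy⟩ := exists_compact_mem_nhds (π y)
  obtain ⟨C, hC, hmem⟩ := exists_isCompact_of_inv_smul_mem (H := H) hK hL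
  have : ContinuousOn (fun y => ∫ h, f y h ∂μ) (π ⁻¹' L) :=
    continuousOn_integral_of_compact_support hC hf.continuousOn fun p h hp hh =>
      h0 p h fun hk => hh (hmem h _ hp hk)
  exact this.continuousAt (hπ.continuousAt.preimage_mem_nhds hy)

end ProperAction

/-! ### Equivariant maps from a bundle to a representation -/

namespace GVectorBundle

variable {H : Type*} [Group H] [TopologicalSpace H]
variable {X : Type u} [TopologicalSpace X] [MulAction H X]

section Total

variable (E : GVectorBundle.{u, v} H X)

/-- The action of a group element on the total space. -/
def transl (g : H) (t : E.Total) : E.Total := ⟨g • t.1, E.act g t.1 t.2⟩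

theorem transl_one (t : E.Total) : E.transl 1 t = t := E.act_one t.1 t.2

theorem transl_mul (g h : H) (t : E.Total) : E.transl (g * h) t = E.transl g (E.transl h t) :=
  E.act_mul g h t.1 t.2

theorem continuous_transl : Continuous fun p : H × E.Total => E.transl p.1 p.2 :=
  E.continuous_act

variable {E}

/-- The inverse of a local trivialization is continuous as a map to the total space. -/
theorem continuous_trivialization_symm {U : Set X} {n : ℕ}
    {φ : ∀ x : U, E.Fiber x ≃ₗ[ℂ] (Fin n → ℂ)}
    (hφ : IsHomeomorph (fun t : {t : Σ x, E.Fiber x // t.1 ∈ U} =>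
        ((⟨t.1.1, t.2⟩, φ ⟨t.1.1, t.2⟩ t.1.2) : U × (Fin n → ℂ)))) :
    Continuous fun q : U × (Fin n → ℂ) => (⟨q.1, (φ q.1).symm q.2⟩ : E.Total) := by
  obtain ⟨cφ, φ', hφl, hφr, cφ'⟩ := isHomeomorph_iff_exists_inverse.1 hφ
  refine (continuous_subtype_val.comp cφ').congr fun q => ?_
  change (φ' q).1 = _
  have : φ' q = ⟨⟨q.1, (φ q.1).symm q.2⟩, q.1.2⟩ := by
    rw [← hφl ⟨⟨q.1, (φ q.1).symm q.2⟩, q.1.2⟩]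
    simp
  rw [this]

theorem continuous_functional_transl [ContinuousInv H] {s : ∀ x, E.Fiber x →ₗ[ℂ] ℂ}
    (hs : Continuous fun t : E.Total => s t.1 t.2) :
    Continuous fun p : H × E.Total => s (p.1⁻¹ • p.2.1) (E.act p.1⁻¹ p.2.1 p.2.2) :=
  hs.comp (E.continuous_transl.comp (continuous_fst.inv.prodMk continuous_snd))

/-- There are enough compactly supported fibrewise linear functions. -/
theorem exists_functional [T2Space X] [LocallyCompactSpace X] (x₀ : X) (e₀ : E.Fiber x₀)
    (he : e₀ ≠ 0) :
    ∃ (s : ∀ x, E.Fiber x →ₗ[ℂ] ℂ) (K : Set X), IsCompact K ∧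
      (Continuous fun t : E.Total => s t.1 t.2) ∧ (∀ x ∉ K, s x = 0) ∧ s x₀ e₀ ≠ 0 := by
  classical
  obtain ⟨U, hU, hxU, n, φ, hφ⟩ := E.locally_trivial x₀
  obtain ⟨L, hL, hxL, hLU⟩ := exists_compact_subset hU hxU
  obtain ⟨b, hb1, hb0, -, -⟩ := exists_continuous_one_zero_of_isCompact
    (isCompact_singleton (x := x₀)) isOpen_interior.isClosed_compl
    (Set.disjoint_left.2 fun y hy hy' => hy' (by rwa [Set.mem_singleton_iff.1 hy]))
  have hbL : ∀ x ∉ L, b x = 0 := fun x hx => hb0 fun h => hx (interior_subset h)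
  have hne : φ ⟨x₀, hxU⟩ e₀ ≠ 0 := by simpa using he
  obtain ⟨i, hi⟩ := Function.ne_iff.1 hne
  -- A coordinate of the trivialization that is nonzero on `e₀`, multiplied by the bump function and
  -- extended by zero. Continuity off `U` holds because `s` vanishes on the open set `Lᶜ`.
  let s : ∀ x, E.Fiber x →ₗ[ℂ] ℂ := fun x =>
    if h : x ∈ U then (b x : ℂ) • (LinearMap.proj i ∘ₗ (φ ⟨x, h⟩).toLinearMap) else 0
  have hs : ∀ x (h : x ∈ U) e, s x e = (b x : ℂ) * φ ⟨x, h⟩ e i := by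
    intro x h e
    simp [s, h]
  have hs0 : ∀ x ∉ L, s x = 0 := by
    intro x hx
    by_cases h : x ∈ U
    · simp [s, h, hbL x hx]
    · simp [s, h]
  refine ⟨s, L, hL, ?_, hs0, ?_⟩
  · rw [continuous_iff_continuousAt]
    intro t
    by_cases ht : t.1 ∈ U
    · have hopen : IsOpen {t : E.Total | t.1 ∈ U} := hU.preimage E.continuous_proj
      refine ContinuousOn.continuousAt (s := {t : E.Total | t.1 ∈ U}) ?_ (hopen.mem_nhds ht)
      rw [continuousOn_iff_continuous_domRestrict]
      have h1 : Continuous fun t : {t : E.Total // t.1 ∈ U} =>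
          (b t.1.1 : ℂ) * φ ⟨t.1.1, t.2⟩ t.1.2 i := by
        refine Continuous.mul ?_ ?_
        · exact Complex.continuous_ofReal.comp
            (b.continuous.comp (E.continuous_proj.comp continuous_subtype_val))
        · exact (continuous_apply i).comp (continuous_snd.comp hφ.continuous)
      exact h1.congr fun t => (hs t.1.1 t.2 t.1.2).symm
    · have hopen : {t : E.Total | t.1 ∈ Lᶜ} ∈ nhds t :=
        (hL.isClosed.isOpen_compl.preimage E.continuous_proj).mem_nhds fun h => ht (hLU h)
      refine (continuousAt_const (y := (0 : ℂ))).congr ?_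
      filter_upwards [hopen] with t' ht'
      rw [hs0 _ ht']
      rfl
  · rw [hs x₀ hxU]
    have : b x₀ = 1 := hb1 rfl
    simpa [this] using hi

end Total

/-- An equivariant morphism from a vector bundle to the trivial bundle with fibre a
representation. -/
structure RepMap (E : GVectorBundle.{u, v} H X) (V : ContFDRep H) where
  toFun : ∀ x, E.Fiber x →ₗ[ℂ] (Fin V.dim → ℂ)
  continuous_toFun : Continuous fun t : E.Total => toFun t.1 t.2
  equivariant : ∀ (g : H) (x : X) (e : E.Fiber x),
    toFun (g • x) (E.act g x e) = V.rep g (toFun x e)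

end GVectorBundle

/-- A representation operator as a continuous linear map. -/
noncomputable def ContFDRep.repCLM {H : Type*} [Group H] [TopologicalSpace H] (V : ContFDRep H)
    (g : H) : (Fin V.dim → ℂ) →L[ℂ] (Fin V.dim → ℂ) := LinearMap.toContinuousLinearMap (V.rep g)

namespace GVectorBundle

open MeasureTheory

variable {H : Type*} [Group H] [TopologicalSpace H] [IsTopologicalGroup H]
variable {X : Type u} [TopologicalSpace X] [MulAction H X] [ProperSMul H X]
  [LocallyCompactSpace X]
variable [MeasurableSpace H] [BorelSpace H] (μ : Measure H) [IsFiniteMeasureOnCompacts μ]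
  [μ.IsMulLeftInvariant]
variable {E : GVectorBundle.{u, v} H X}

section

variable {s : ∀ x, E.Fiber x →ₗ[ℂ] ℂ} (hs : Continuous fun t : E.Total => s t.1 t.2)

/-- The equivariant map `e ↦ ∫ s(h⁻¹ e) h w dh`. -/
noncomputable def averageMap {K : Set X} (hK : IsCompact K) (h0 : ∀ x ∉ K, s x = 0)
    (V : ContFDRep H) (w : Fin V.dim → ℂ) : E.RepMap V :=
  have hV : Continuous fun h : H => V.rep h w :=
    V.continuous_rep.comp (continuous_id.prodMk continuous_const)
  have hc : Continuous fun p : E.Total × H =>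
      s (p.2⁻¹ • p.1.1) (E.act p.2⁻¹ p.1.1 p.1.2) • V.rep p.2 w :=
    ((continuous_functional_transl hs).comp continuous_swap).smul (hV.comp continuous_snd)
  have hi : ∀ x (e : E.Fiber x),
      Integrable (fun h => s (h⁻¹ • x) (E.act h⁻¹ x e) • V.rep h w) μ := fun x e =>
    Continuous.integrable_of_hasCompactSupport
      (hc.comp ((continuous_const (y := (⟨x, e⟩ : E.Total))).prodMk continuous_id))
      (hasCompactSupport_of_properSMul hK x fun h hh => by rw [h0 _ hh]; simp)
  { toFun := fun x =>
      { toFun := fun e => ∫ h, s (h⁻¹ • x) (E.act h⁻¹ x e) • V.rep h w ∂μ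
        map_add' := fun e e' => by
          rw [← integral_add (hi x e) (hi x e')]
          simp only [map_add, add_smul]
        map_smul' := fun c e => by
          rw [RingHom.id_apply, ← integral_smul]
          simp only [map_smul, smul_assoc] }
    continuous_toFun := continuous_integral_of_properSMul μ E.continuous_proj hc hK
      fun t h hh => by
        rw [h0 _ hh]; simp
    equivariant := fun g x e => by
      change ∫ h, s (h⁻¹ • g • x) (E.act h⁻¹ (g • x) (E.act g x e)) • V.rep h w ∂μ =
        V.repCLM g (∫ h, s (h⁻¹ • x) (E.act h⁻¹ x e) • V.rep h w ∂μ)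
      rw [← ContinuousLinearMap.integral_comp_comm _ (hi x e),
        ← integral_mul_left_eq_self _ g]
      refine integral_congr_ae (Filter.Eventually.of_forall fun h => ?_)
      -- The equality is stated in the total space because the two vectors lie over base points that
      -- are only propositionally equal.
      have h1 : E.transl (g * h)⁻¹ (E.transl g ⟨x, e⟩) = E.transl h⁻¹ ⟨x, e⟩ := by
        rw [← transl_mul]; simp
      have h2 := congrArg (fun t : E.Total => s t.1 t.2) h1
      change s ((g * h)⁻¹ • g • x) (E.act (g * h)⁻¹ (g • x) (E.act g x e)) =
        s (h⁻¹ • x) (E.act h⁻¹ x e) at h2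
      simp only [h2]
      change _ = V.rep g _
      rw [map_smul, map_mul]
      rfl }

/-- When `l (V.rep h w)` is a given representative function, this turns nonvanishing of the
equivariant map at `e` into nonvanishing of a scalar pairing on `H`. -/
theorem averageMap_apply {K : Set X} (hK : IsCompact K) (h0 : ∀ x ∉ K, s x = 0)
    (V : ContFDRep H) (w : Fin V.dim → ℂ) (l : (Fin V.dim → ℂ) →L[ℂ] ℂ) (x : X)
    (e : E.Fiber x) :
    l ((averageMap μ hs hK h0 V w).toFun x e) =
      ∫ h, s (h⁻¹ • x) (E.act h⁻¹ x e) * l (V.rep h w) ∂μ := by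
  have hV : Continuous fun h : H => V.rep h w :=
    V.continuous_rep.comp (continuous_id.prodMk continuous_const)
  have hi : Integrable (fun h => s (h⁻¹ • x) (E.act h⁻¹ x e) • V.rep h w) μ :=
    Continuous.integrable_of_hasCompactSupport
      (((continuous_functional_transl hs).comp
        (continuous_id.prodMk (continuous_const (y := (⟨x, e⟩ : E.Total))))).smul hV)
      (hasCompactSupport_of_properSMul hK x fun h hh => by rw [h0 _ hh]; simp)
  change l (∫ h, s (h⁻¹ • x) (E.act h⁻¹ x e) • V.rep h w ∂μ) = _
  rw [← ContinuousLinearMap.integral_comp_comm _ hi]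
  simp

end

end GVectorBundle

/-! ### Pairing compactly supported functions with representative functions -/

section Pairing

open MeasureTheory

/-- A nonzero compactly supported function pairs nontrivially with a separating algebra. -/
theorem exists_integral_mul_ne_zero {Y : Type*} [TopologicalSpace Y] [MeasurableSpace Y]
    [BorelSpace Y] (μ : Measure Y) [IsFiniteMeasureOnCompacts μ] [μ.IsOpenPosMeasure]
    (R : StarSubalgebra ℂ C(Y, ℂ)) (hR : ∀ x y, x ≠ y → ∃ f ∈ R, f x ≠ f y)
    {m : Y → ℂ} (hm : Continuous m) (hmc : HasCompactSupport m) {y : Y} (hy : m y ≠ 0) :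
    ∃ f ∈ R, ∫ x, m x * f x ∂μ ≠ 0 := by
  have hpos : 0 < ∫ x, ‖m x‖ ^ 2 ∂μ :=
    Continuous.integral_pos_of_hasCompactSupport_nonneg_nonzero (x := y) (by fun_prop)
      (hmc.norm.comp_left (g := fun r : ℝ => r ^ 2) (by simp)) (fun x => by positivity)
      (by simpa using hy)
  have hI : 0 ≤ ∫ x, ‖m x‖ ∂μ := integral_nonneg fun x => norm_nonneg _
  -- The tolerance `ε` satisfies `ε ∫ ‖m‖ < ∫ ‖m‖²`; the added 1 keeps the denominator positive. If
  -- `∫ m f` vanished, then `∫ m (f - star m)` would have norm `∫ ‖m‖²`, although it is at most `ε ∫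
  -- ‖m‖`.
  obtain ⟨f, hf, hfK⟩ := exists_mem_starSubalgebra_near R hR hmc
    (φ := fun x => star (m x)) (by fun_prop)
    (show 0 < (∫ x, ‖m x‖ ^ 2 ∂μ) / (∫ x, ‖m x‖ ∂μ + 1) by positivity)
  set ε := (∫ x, ‖m x‖ ^ 2 ∂μ) / (∫ x, ‖m x‖ ∂μ + 1) with hε
  refine ⟨f, hf, fun h => ?_⟩
  have i1 : Integrable (fun x => m x * f x) μ :=
    Continuous.integrable_of_hasCompactSupport (by fun_prop) hmc.mul_right
  have i2 : Integrable (fun x => m x * star (m x)) μ :=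
    Continuous.integrable_of_hasCompactSupport (by fun_prop) hmc.mul_right
  have e1 : ∫ x, m x * (f x - star (m x)) ∂μ = -((∫ x, ‖m x‖ ^ 2 ∂μ : ℝ) : ℂ) := by
    simp only [mul_sub]
    rw [integral_sub i1 i2, h, zero_sub, ← integral_complex_ofReal]
    congr 2
    funext x
    simpa using Complex.mul_conj' (m x)
  have e2 : ‖∫ x, m x * (f x - star (m x)) ∂μ‖ ≤ ∫ x, ‖m x‖ * ε ∂μ := by
    refine norm_integral_le_of_norm_le
      ((hm.norm.integrable_of_hasCompactSupport hmc.norm).mul_const _)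
      (Filter.Eventually.of_forall fun x => ?_)
    rw [norm_mul]
    by_cases hx : x ∈ tsupport m
    · exact mul_le_mul_of_nonneg_left (hfK x hx).le (norm_nonneg _)
    · simp [image_eq_zero_of_notMem_tsupport hx]
  rw [e1, norm_neg, Complex.norm_real, Real.norm_of_nonneg hpos.le, integral_mul_const] at e2
  have : (∫ x, ‖m x‖ ∂μ) * ε < ∫ x, ‖m x‖ ^ 2 ∂μ := by
    rw [hε, ← mul_div_assoc, div_lt_iff₀ (by positivity)]
    nlinarith
  linarith

end Pairing

namespace GVectorBundle

open MeasureTheory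

variable {H : Type*} [Group H] [TopologicalSpace H] [IsTopologicalGroup H]
  [LocallyCompactSpace H]
variable {X : Type u} [TopologicalSpace X] [MulAction H X] [ProperSMul H X]
  [LocallyCompactSpace X] [T2Space X]

/-- Equivariant maps to representations detect the points of the total space of a bundle. -/
theorem exists_repMap_ne_zero
    (hR : ∀ x y : H, x ≠ y → ∃ f ∈ representativeFunctions H, f x ≠ f y)
    (E : GVectorBundle.{u, v} H X) (x : X) (e : E.Fiber x) (he : e ≠ 0) :
    ∃ (V : ContFDRep H) (Φ : E.RepMap V), Φ.toFun x e ≠ 0 := by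
  borelize H
  let μ : Measure H := Measure.haar
  obtain ⟨s, K, hK, hs, h0, hse⟩ := exists_functional x e he
  let m : H → ℂ := fun h => s (h⁻¹ • x) (E.act h⁻¹ x e)
  have hm : Continuous m := (continuous_functional_transl hs).comp
    (continuous_id.prodMk (continuous_const (y := (⟨x, e⟩ : E.Total))))
  have hmc : HasCompactSupport m :=
    hasCompactSupport_of_properSMul hK x fun h hh => by simp [m, h0 _ hh]
  have hm1 : m 1 ≠ 0 := by
    have h1 : E.transl (1 : H)⁻¹ ⟨x, e⟩ = ⟨x, e⟩ := by rw [inv_one, transl_one]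
    have h2 : m 1 = s x e := congrArg (fun t : E.Total => s t.1 t.2) h1
    rwa [h2]
  obtain ⟨f, hf, hne⟩ := exists_integral_mul_ne_zero μ _ hR hm hmc hm1
  obtain ⟨V, w, l, hl⟩ := IsRepresentative.exists_matrixCoefficient hf
  refine ⟨V, averageMap μ hs hK h0 V w, fun h => hne ?_⟩
  have := averageMap_apply μ hs hK h0 V w l x e
  rw [h, map_zero] at this
  simp only [hl]
  exact this.symm

end GVectorBundle

/-- Submodules of a finite-dimensional space with trivial intersection contain finitely many with
trivial intersection. -/
theorem Submodule.exists_finset_inf_eq_bot {K M S : Type*} [Field K] [AddCommGroup M] [Module K M]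
    [FiniteDimensional K M] (k : S → Submodule K M) (h : ∀ e ≠ 0, ∃ p, e ∉ k p) :
    ∃ t : Finset S, t.inf k = ⊥ := by
  classical
  let N : Finset S → ℕ := fun t => Module.finrank K ↥(t.inf k)
  -- Take a finite intersection of least dimension. A nonzero vector left in it would be excluded by
  -- one further submodule, which would lower the dimension.
  have ht := Function.argmin_le N
  set t := Function.argmin N
  refine ⟨t, (Submodule.eq_bot_iff _).2 fun e he => ?_⟩
  by_contra hne
  obtain ⟨p, hp⟩ := h e hne
  have hlt : (insert p t).inf k < t.inf k := by
    refine lt_of_le_of_ne (Finset.inf_mono (Finset.subset_insert _ _)) fun heq => ?_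
    rw [← heq, Submodule.mem_finsetInf] at he
    exact hp (he _ (Finset.mem_insert_self _ _))
  exact absurd (ht (insert p t)) (not_le.2 (Submodule.finrank_lt_finrank_of_lt hlt))

/-! ### From detecting single vectors to a map injective on every fibre -/

namespace GVectorBundle

variable {H : Type*} [Group H] [TopologicalSpace H]
variable {X : Type u} [TopologicalSpace X] [MulAction H X]

namespace RepMap

variable {E : GVectorBundle.{u, v} H X}

/-- The morphism to a direct sum with given components. -/
noncomputable def pi {ι : Type*} [Fintype ι] {V : ι → ContFDRep H} (Φ : ∀ i, E.RepMap (V i)) :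
    E.RepMap (ContFDRep.ofFiniteDimensional (ContFDRep.piRep V)
      (ContFDRep.continuous_piRep V)) where
  toFun x := (ContFDRep.ofFiniteDimensionalEquiv (ContFDRep.piRep V)
    (ContFDRep.continuous_piRep V)).toLinearEquiv.toLinearMap ∘ₗ
      LinearMap.pi fun i => (Φ i).toFun x
  continuous_toFun :=
    (ContFDRep.ofFiniteDimensionalEquiv (ContFDRep.piRep V)
      (ContFDRep.continuous_piRep V)).continuous.comp
        (continuous_pi fun i => (Φ i).continuous_toFun)
  equivariant g x e := by
    change ContFDRep.ofFiniteDimensionalEquiv _ _ (fun i => (Φ i).toFun _ _) =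
      (ContFDRep.ofFiniteDimensional _ _).rep g (ContFDRep.ofFiniteDimensionalEquiv _ _
        (fun i => (Φ i).toFun x e))
    rw [ContFDRep.ofFiniteDimensional_rep]
    congr 1
    funext i
    exact (Φ i).equivariant g x e

theorem pi_eq_zero_iff {ι : Type*} [Fintype ι] {V : ι → ContFDRep H}
    (Φ : ∀ i, E.RepMap (V i)) (x : X) (e : E.Fiber x) :
    (pi Φ).toFun x e = 0 ↔ ∀ i, (Φ i).toFun x e = 0 := by
  change ContFDRep.ofFiniteDimensionalEquiv _ _ (fun i => (Φ i).toFun _ _) = 0 ↔ _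
  rw [map_eq_zero_iff _ (ContinuousLinearEquiv.injective _), funext_iff]
  rfl

variable {V : ContFDRep H} (Φ : E.RepMap V)

/-- In a trivialization the map is a continuous family of `n`-tuples, the images of the standard
basis. Injectivity is their linear independence, an open condition. -/
theorem isOpen_setOf_injective : IsOpen {x | Function.Injective (Φ.toFun x)} := by
  rw [isOpen_iff_mem_nhds]
  intro x₀ hx₀
  obtain ⟨U, hU, hxU, n, φ, hφ⟩ := E.locally_trivial x₀
  let B : U → Fin n → (Fin V.dim → ℂ) := fun x i => Φ.toFun x ((φ x).symm (Pi.single i 1))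
  have hB : Continuous B := continuous_pi fun i =>
    Φ.continuous_toFun.comp ((continuous_trivialization_symm hφ).comp
      (continuous_id.prodMk continuous_const))
  have key : ∀ x : U, LinearIndependent ℂ (B x) ↔ Function.Injective (Φ.toFun x) := by
    intro x
    let L : (Fin n → ℂ) →ₗ[ℂ] (Fin V.dim → ℂ) := Φ.toFun x ∘ₗ (φ x).symm.toLinearMap
    have h1 : Fintype.linearCombination ℂ (B x) = L := by
      refine LinearMap.pi_ext' fun i => LinearMap.ext_ring ?_
      simp [B, L]
    have h2 : Function.Injective L ↔ Function.Injective (Φ.toFun x) := by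
      simp only [L, LinearMap.coe_comp, LinearEquiv.coe_coe]
      exact Function.Injective.of_comp_iff' _ (φ x).symm.bijective
    rw [← h2, ← h1]
    exact linearIndependent_iff_injective_fintypeLinearCombination
  have hopen : IsOpen (B ⁻¹' {f | LinearIndependent ℂ f}) :=
    isOpen_setOfPred_linearIndependent.preimage hB
  refine Filter.mem_of_superset
    ((hU.isOpenMap_subtype_val _ hopen).mem_nhds ⟨⟨x₀, hxU⟩, (key _).2 hx₀, rfl⟩) ?_
  rintro _ ⟨x, hx, rfl⟩
  exact (key x).1 hx

/-- By equivariance, `g⁻¹` carries the kernel over `g • x` into the kernel over `x`. -/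
theorem injective_smul {x : X} (hx : Function.Injective (Φ.toFun x)) (g : H) :
    Function.Injective (Φ.toFun (g • x)) := by
  rw [injective_iff_map_eq_zero] at hx ⊢
  intro e he
  -- Generalizing the base point avoids a cast, as `g⁻¹ • g • x` is not definitionally `x`.
  have hx' : ∀ y, y = x → ∀ e : E.Fiber y, Φ.toFun y e = 0 → e = 0 := by
    rintro _ rfl
    exact hx
  have h1 : E.transl g (E.transl g⁻¹ ⟨g • x, e⟩) = ⟨g • x, e⟩ := by
    rw [← transl_mul, mul_inv_cancel, transl_one]
  have h2 : (E.transl g⁻¹ ⟨g • x, e⟩).2 = 0 := by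
    refine hx' _ (inv_smul_smul g x) _ ?_
    change Φ.toFun (g⁻¹ • g • x) (E.act g⁻¹ (g • x) e) = 0
    rw [Φ.equivariant, he, map_zero]
  have h3 : (E.transl g (E.transl g⁻¹ ⟨g • x, e⟩)).2 = 0 := by
    change E.act g _ (E.transl g⁻¹ ⟨g • x, e⟩).2 = 0
    rw [h2, map_zero]
  rw [h1] at h3
  exact h3

end RepMap

/-- If the vectors of a fibre are detected by equivariant maps, then one such map is injective on
this fibre. -/
theorem exists_repMap_injective_at (E : GVectorBundle.{u, v} H X) (x : X)
    (h : ∀ e : E.Fiber x, e ≠ 0 → ∃ (V : ContFDRep H) (Φ : E.RepMap V), Φ.toFun x e ≠ 0) :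
    ∃ (V : ContFDRep H) (Φ : E.RepMap V), Function.Injective (Φ.toFun x) := by
  classical
  obtain ⟨U, -, hxU, n, φ, -⟩ := E.locally_trivial x
  have : FiniteDimensional ℂ (E.Fiber x) :=
    FiniteDimensional.of_injective (φ ⟨x, hxU⟩).toLinearMap (φ ⟨x, hxU⟩).injective
  obtain ⟨t, ht⟩ := Submodule.exists_finset_inf_eq_bot
    (fun p : Σ V : ContFDRep H, E.RepMap V => LinearMap.ker (p.2.toFun x)) fun e he => by
      obtain ⟨V, Φ, hΦ⟩ := h e he
      exact ⟨⟨V, Φ⟩, hΦ⟩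
  refine ⟨_, RepMap.pi (V := fun p : t => p.1.1) fun p => p.1.2, ?_⟩
  rw [injective_iff_map_eq_zero]
  intro e he
  rw [RepMap.pi_eq_zero_iff] at he
  have het : e ∈ t.inf fun p : Σ V : ContFDRep H, E.RepMap V => LinearMap.ker (p.2.toFun x) := by
    rw [Submodule.mem_finsetInf]
    exact fun p hp => he ⟨p, hp⟩
  rwa [ht] at het

end GVectorBundle

/-- If the orbit space is compact, then finitely many members of a family of open sets meeting
every orbit meet every orbit. -/
theorem exists_finset_smul_mem {H X ι : Type*} [Group H] [TopologicalSpace X]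
    [MulAction H X] [ContinuousConstSMul H X] [CompactSpace (MulAction.orbitRel.Quotient H X)]
    (O : ι → Set X) (hO : ∀ i, IsOpen (O i)) (hc : ∀ x, ∃ i, x ∈ O i) :
    ∃ t : Finset ι, ∀ x, ∃ i ∈ t, ∃ g : H, g • x ∈ O i := by
  let π : X → MulAction.orbitRel.Quotient H X := Quotient.mk (MulAction.orbitRel H X)
  obtain ⟨t, ht⟩ := isCompact_univ.elim_finite_subcover (fun i => π '' O i)
    (fun i => (MulAction.isOpenQuotientMap_quotientMk (Γ := H)).isOpenMap _ (hO i)) (by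
      intro q _
      induction q using Quotient.inductionOn with | _ x
      obtain ⟨i, hi⟩ := hc x
      exact Set.mem_iUnion.2 ⟨i, x, hi, rfl⟩)
  refine ⟨t, fun x => ?_⟩
  have hx := ht (Set.mem_univ (π x))
  simp only [Set.mem_iUnion] at hx
  obtain ⟨i, hi, z, hz, hzx⟩ := hx
  obtain ⟨g, hg⟩ := MulAction.orbitRel_apply.1 (Quotient.exact hzx)
  exact ⟨i, hi, g, (show g • x = z from hg) ▸ hz⟩

namespace GVectorBundle

variable {H : Type*} [Group H] [TopologicalSpace H]
variable {X : Type u} [TopologicalSpace X] [MulAction H X]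

/-- Each fibre has a map that is injective on nearby fibres and on their translates, so finitely
many maps handle all orbits. Their direct sum is injective wherever one of them is. -/
theorem exists_repMap_injective [ContinuousConstSMul H X]
    [CompactSpace (MulAction.orbitRel.Quotient H X)] (E : GVectorBundle.{u, v} H X)
    (h : ∀ x (e : E.Fiber x), e ≠ 0 →
      ∃ (V : ContFDRep H) (Φ : E.RepMap V), Φ.toFun x e ≠ 0) :
    ∃ (V : ContFDRep H) (Φ : E.RepMap V), ∀ x, Function.Injective (Φ.toFun x) := by
  choose V Φ hΦ using fun x => exists_repMap_injective_at E x (h x)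
  obtain ⟨t, ht⟩ := exists_finset_smul_mem (H := H)
    (fun x => {y | Function.Injective ((Φ x).toFun y)})
    (fun x => (Φ x).isOpen_setOf_injective) fun x => ⟨x, hΦ x⟩
  refine ⟨_, RepMap.pi fun p : t => Φ p, fun x => ?_⟩
  obtain ⟨i, hi, g, hg⟩ := ht x
  have hinj := (Φ i).injective_smul hg g⁻¹
  rw [inv_smul_smul] at hinj
  rw [injective_iff_map_eq_zero] at hinj ⊢
  intro e he
  rw [RepMap.pi_eq_zero_iff] at he
  exact hinj e (he ⟨i, hi⟩)

end GVectorBundle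

/-! ### Invariant Hermitian metrics -/

section Metric

open MeasureTheory

variable {H : Type*} [Group H] [TopologicalSpace H]
variable {X : Type*} [TopologicalSpace X] [MulAction H X] [ProperSMul H X]
  [LocallyCompactSpace X] [T2Space X]

/-- A compactly supported nonnegative function which does not vanish identically on any orbit. -/
theorem exists_cutoff [CompactSpace (MulAction.orbitRel.Quotient H X)] :
    ∃ b : C(X, ℝ), HasCompactSupport b ∧ (∀ x, 0 ≤ b x) ∧ ∀ x, ∃ g : H, b (g • x) ≠ 0 := by
  -- With an empty zero set, Urysohn's lemma just gives a compactly supported function equal to 1 at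
  -- the chosen point.
  choose b hb1 _ hbc hb0 using fun x : X => exists_continuous_one_zero_of_isCompact
    (isCompact_singleton (x := x)) isClosed_empty (Set.disjoint_empty _)
  obtain ⟨t, ht⟩ := exists_finset_smul_mem (H := H) (fun x => {y | b x y ≠ 0})
    (fun x => isOpen_ne_fun (b x).continuous continuous_const) fun x =>
      ⟨x, by simp [show b x x = 1 from hb1 x rfl]⟩
  refine ⟨∑ i ∈ t, b i, ?_, fun x => ?_, fun x => ?_⟩
  · have : ∀ s : Finset X, HasCompactSupport (∑ i ∈ s, b i : C(X, ℝ)) := by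
      classical
      intro s
      induction s using Finset.induction_on with
      | empty => simpa using HasCompactSupport.zero
      | insert a s ha ih =>
        rw [Finset.sum_insert ha, ContinuousMap.coe_add]
        exact (hbc a).add ih
    exact this t
  · rw [ContinuousMap.sum_apply]
    exact Finset.sum_nonneg fun i _ => (hb0 i x).1
  · obtain ⟨i, hi, g, hg⟩ := ht x
    refine ⟨g, ?_⟩
    rw [ContinuousMap.sum_apply]
    exact (Finset.sum_pos' (fun j _ => (hb0 j _).1)
      ⟨i, hi, lt_of_le_of_ne (hb0 i _).1 (Ne.symm hg)⟩).ne'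

/-- The trivial bundle whose fibre is a representation has an invariant Hermitian metric. -/
theorem exists_invariant_metric [IsTopologicalGroup H] [LocallyCompactSpace H]
    [CompactSpace (MulAction.orbitRel.Quotient H X)] (V : ContFDRep H) :
    ∃ M : X → (Fin V.dim → ℂ) →ₗ⋆[ℂ] (Fin V.dim → ℂ) →ₗ[ℂ] ℂ,
      (Continuous fun p : X × (Fin V.dim → ℂ) × (Fin V.dim → ℂ) => M p.1 p.2.1 p.2.2) ∧
      (∀ (g : H) x v w, M (g • x) (V.rep g v) (V.rep g w) = M x v w) ∧
      ∀ x v, M x v v = 0 → v = 0 := by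
  borelize H
  let μ : Measure H := Measure.haar
  obtain ⟨b, hbc, hb0, hb⟩ := exists_cutoff (H := H) (X := X)
  -- The standard Hermitian form transported by `h` and weighted by the cutoff at `h⁻¹ • x`. The
  -- weight makes the integrand compactly supported in `h`.
  let f : X × (Fin V.dim → ℂ) × (Fin V.dim → ℂ) → H → ℂ := fun p h =>
    (b (h⁻¹ • p.1) : ℂ) * (star (V.rep h⁻¹ p.2.1) ⬝ᵥ V.rep h⁻¹ p.2.2)
  have hf : Continuous f.uncurry := by
    have h1 : Continuous fun p : (X × (Fin V.dim → ℂ) × (Fin V.dim → ℂ)) × H =>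
        V.rep p.2⁻¹ p.1.2.1 :=
      V.continuous_rep.comp (f := fun p : (X × (Fin V.dim → ℂ) × (Fin V.dim → ℂ)) × H =>
        (p.2⁻¹, p.1.2.1)) (by fun_prop)
    have h2 : Continuous fun p : (X × (Fin V.dim → ℂ) × (Fin V.dim → ℂ)) × H =>
        V.rep p.2⁻¹ p.1.2.2 :=
      V.continuous_rep.comp (f := fun p : (X × (Fin V.dim → ℂ) × (Fin V.dim → ℂ)) × H =>
        (p.2⁻¹, p.1.2.2)) (by fun_prop)
    refine Continuous.mul ?_ (h1.star.dotProduct h2)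
    exact Complex.continuous_ofReal.comp (b.continuous.comp (by fun_prop))
  have hf0 : ∀ p h, h⁻¹ • p.1 ∉ tsupport b → f p h = 0 := fun p h hh => by
    simp [f, image_eq_zero_of_notMem_tsupport hh]
  have hi : ∀ p, Integrable (f p) μ := fun p =>
    Continuous.integrable_of_hasCompactSupport
      (hf.comp ((continuous_const (y := p)).prodMk continuous_id))
      (hasCompactSupport_of_properSMul hbc p.1 (hf0 p))
  let M : X → (Fin V.dim → ℂ) →ₗ⋆[ℂ] (Fin V.dim → ℂ) →ₗ[ℂ] ℂ := fun x =>
    LinearMap.mk₂'ₛₗ (starRingEnd ℂ) (RingHom.id ℂ) (fun v w => ∫ h, f (x, v, w) h ∂μ)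
      (fun v v' w => by
        rw [← integral_add (hi _) (hi _)]
        simp only [f, map_add, star_add, add_dotProduct, mul_add])
      (fun c v w => by
        rw [← integral_smul]
        simp only [f, map_smul, star_smul, smul_dotProduct, smul_eq_mul, starRingEnd_apply]
        congr 1
        funext h
        ring)
      (fun v w w' => by
        rw [← integral_add (hi _) (hi _)]
        simp only [f, map_add, dotProduct_add, mul_add])
      (fun c v w => by
        rw [← integral_smul]
        simp only [f, map_smul, dotProduct_smul, smul_eq_mul, RingHom.id_apply]
        congr 1
        funext h
        ring)
  have hM : ∀ x v w, M x v w = ∫ h, f (x, v, w) h ∂μ := fun x v w => rfl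
  refine ⟨M, ?_, fun g x v w => ?_, fun x v hv => ?_⟩
  · exact continuous_integral_of_properSMul μ continuous_fst hf hbc hf0
  · rw [hM, hM, ← integral_mul_left_eq_self _ g]
    congr 1
    funext h
    have h1 : ∀ u, V.rep (g * h)⁻¹ (V.rep g u) = V.rep h⁻¹ u := by
      intro u
      rw [← Module.End.mul_apply, ← map_mul]
      simp
    simp only [f, h1, smul_smul]
    simp
  · by_contra hne
    obtain ⟨g, hg⟩ := hb x
    -- On the diagonal the integrand is real and nonnegative. If `v ≠ 0`, it is positive at `h =
    -- g⁻¹`, since the cutoff does not vanish at `g • x`.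
    let F : H → ℝ := fun h => b (h⁻¹ • x) * ∑ i, ‖V.rep h⁻¹ v i‖ ^ 2
    have hF : ∀ h, f (x, v, v) h = F h := by
      intro h
      simp only [f, F, dotProduct, Complex.ofReal_mul, Complex.ofReal_sum, Complex.ofReal_pow]
      congr 1
      refine Finset.sum_congr rfl fun i _ => ?_
      exact Complex.conj_mul' _
    have hFre : F = fun h => (f (x, v, v) h).re := by
      funext h
      rw [hF, Complex.ofReal_re]
    have hFc : Continuous F := by
      rw [hFre]
      exact Complex.continuous_re.comp
        (hf.comp ((continuous_const (y := (x, v, v))).prodMk continuous_id))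
    have hpos : 0 < ∫ h, F h ∂μ := by
      refine hFc.integral_pos_of_hasCompactSupport_nonneg_nonzero (x := g⁻¹)
        (hasCompactSupport_of_properSMul hbc x fun h hh => ?_) (fun h => ?_) ?_
      · rw [hFre]
        simp only
        rw [hf0 _ _ hh, Complex.zero_re]
      · exact mul_nonneg (hb0 _) (Finset.sum_nonneg fun i _ => by positivity)
      · simp only [F, inv_inv]
        refine mul_ne_zero hg fun h0 => hne ?_
        rw [Finset.sum_eq_zero_iff_of_nonneg fun i _ => by positivity] at h0
        have h1 : V.rep g v = 0 := funext fun i => by simpa using h0 i (Finset.mem_univ i)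
        have h2 : V.rep g⁻¹ (V.rep g v) = v := by
          rw [← Module.End.mul_apply, ← map_mul]
          simp
        rw [← h2, h1, map_zero]
    rw [hM] at hv
    simp only [hF] at hv
    rw [integral_complex_ofReal] at hv
    exact hpos.ne' (by exact_mod_cast hv)

end Metric

/-! ### Kernel bundles -/

namespace GVectorBundle

variable {H : Type*} [Group H] [TopologicalSpace H]
variable {X : Type u} [TopologicalSpace X] [MulAction H X] [ContinuousSMul H X]

/-- A family of subspaces of `ℂᵐ` is locally the kernel of a continuous family of surjections. -/
def IsLocallyKernel {m : ℕ} (F : X → Submodule ℂ (Fin m → ℂ)) : Prop :=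
  ∀ x₀, ∃ U : Set X, IsOpen U ∧ x₀ ∈ U ∧ ∃ (n : ℕ)
    (C : X → (Fin m → ℂ) →L[ℂ] (Fin n → ℂ)), ContinuousOn C U ∧
      (∀ x ∈ U, ∀ v, v ∈ F x ↔ C x v = 0) ∧ Function.Surjective (C x₀)

/-- With a right inverse `R` of `C x₀`, the operator `T x = 1 + R (C x - C x₀)` satisfies `C x₀ ∘ T
x = C x` and is the identity at `x₀`. It is therefore invertible nearby and carries the kernel of `C
x` onto the fixed kernel of `C x₀`. Surjectivity at `x₀` alone is enough. -/
theorem IsLocallyKernel.locally_trivial {m : ℕ} {F : X → Submodule ℂ (Fin m → ℂ)}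
    (hF : IsLocallyKernel F) [tS : TopologicalSpace (Σ x, F x)]
    (ht : Topology.IsInducing fun t : Σ x, F x => ((t.1, t.2) : X × (Fin m → ℂ))) (x₀ : X) :
    ∃ U : Set X, IsOpen U ∧ x₀ ∈ U ∧ ∃ n : ℕ,
      ∃ φ : ∀ x : U, F x ≃ₗ[ℂ] (Fin n → ℂ),
        IsHomeomorph (fun t : {t : Σ x, F x // t.1 ∈ U} =>
          ((⟨t.1.1, t.2⟩, φ ⟨t.1.1, t.2⟩ t.1.2) : U × (Fin n → ℂ))) := by
  obtain ⟨U, hU, hxU, n, C, hC, hker, hsurj⟩ := hF x₀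
  obtain ⟨R, hR⟩ := (C x₀).exists_rightInverse_of_surjective (LinearMap.range_eq_top.2 hsurj)
  have hR' : ∀ w, C x₀ (R w) = w := fun w => DFunLike.congr_fun hR w
  let T : X → (Fin m → ℂ) →L[ℂ] (Fin m → ℂ) := fun x => 1 + R.comp (C x - C x₀)
  have hT : ContinuousOn T U :=
    continuousOn_const.add ((continuousOn_const (c := R)).clm_comp (hC.sub continuousOn_const))
  have hCT : ∀ x v, C x₀ (T x v) = C x v := by
    intro x v
    simp [T, hR']
  let W : Set X := U ∩ T ⁻¹' {a | IsUnit a}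
  have hW : IsOpen W := hT.isOpen_inter_preimage hU Units.isOpen
  have hxW : x₀ ∈ W := ⟨hxU, by simp [T]⟩
  have hinv : ∀ x ∈ W, ∀ v, Ring.inverse (T x) (T x v) = v := fun x hx v =>
    DFunLike.congr_fun (Ring.inverse_mul_cancel _ hx.2) v
  have hinv' : ∀ x ∈ W, ∀ v, T x (Ring.inverse (T x) v) = v := fun x hx v =>
    DFunLike.congr_fun (Ring.mul_inverse_cancel _ hx.2) v
  have hTi : ContinuousOn (fun x => Ring.inverse (T x)) W := by
    intro x hx
    obtain ⟨a, ha⟩ := hx.2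
    have h1 : ContinuousAt Ring.inverse (T x) := ha ▸ NormedRing.inverse_continuousAt a
    exact h1.comp_continuousWithinAt ((hT x hx.1).mono Set.inter_subset_left)
  let N : Submodule ℂ (Fin m → ℂ) := LinearMap.ker (C x₀).toLinearMap
  let ψ : ∀ x : W, F x ≃ₗ[ℂ] N := fun x =>
    { toFun := fun v => ⟨T x v, by
        change C x₀ (T x v) = 0
        rw [hCT]
        exact (hker x x.2.1 v).1 v.2⟩
      map_add' := fun v w => Subtype.ext (by simp)
      map_smul' := fun c v => Subtype.ext (by simp)
      invFun := fun v => ⟨Ring.inverse (T x) v, by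
        rw [hker x x.2.1, ← hCT, hinv' x x.2]
        exact v.2⟩
      left_inv := fun v => Subtype.ext (hinv x x.2 v)
      right_inv := fun v => Subtype.ext (hinv' x x.2 v) }
  let L : N ≃L[ℂ] (Fin (Module.finrank ℂ N) → ℂ) :=
    (Module.finBasis ℂ N).equivFun.toContinuousLinearEquiv
  refine ⟨W, hW, hxW, Module.finrank ℂ N, fun x => (ψ x).trans L.toLinearEquiv, ?_⟩
  rw [isHomeomorph_iff_exists_inverse]
  refine ⟨?_, fun q => ⟨⟨q.1, (ψ q.1).symm (L.symm q.2)⟩, q.1.2⟩, fun t => ?_, fun q => ?_, ?_⟩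
  · have h1 : Continuous fun t : {t : Σ x, F x // t.1 ∈ W} => t.1.1 :=
      continuous_fst.comp (ht.continuous.comp continuous_subtype_val)
    have h2 : Continuous fun t : {t : Σ x, F x // t.1 ∈ W} => (t.1.2 : Fin m → ℂ) :=
      continuous_snd.comp (ht.continuous.comp continuous_subtype_val)
    refine (h1.subtype_mk _).prodMk (L.continuous.comp (Continuous.subtype_mk ?_ _))
    exact ((hT.mono Set.inter_subset_left).comp_continuous h1 fun t => t.2).clm_apply h2
  · simp
  · simp
  · refine Continuous.subtype_mk (ht.continuous_iff.2 ?_) _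
    have h1 : Continuous fun q : W × (Fin (Module.finrank ℂ N) → ℂ) => (q.1 : X) :=
      continuous_subtype_val.comp continuous_fst
    refine h1.prodMk ?_
    exact (hTi.comp_continuous h1 fun q => q.1.2).clm_apply
      (continuous_subtype_val.comp (L.symm.continuous.comp continuous_snd))

/-- The subbundle of a trivial bundle formed by an invariant family of subspaces which is locally
the kernel of a continuous family of surjections. -/
noncomputable def kernelBundle (V : ContFDRep H) (F : X → Submodule ℂ (Fin V.dim → ℂ))
    (hF : IsLocallyKernel F) (hinv : ∀ (g : H) x, ∀ v ∈ F x, V.rep g v ∈ F (g • x)) :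
    GVectorBundle.{u, 0} H X where
  Fiber x := F x
  topology := TopologicalSpace.induced
    (fun t => ((t.1, t.2) : X × (Fin V.dim → ℂ))) inferInstance
  continuous_proj := by
    let tS : TopologicalSpace (Σ x, F x) := TopologicalSpace.induced
      (fun t => ((t.1, t.2) : X × (Fin V.dim → ℂ))) inferInstance
    have cS : Continuous (fun t : Σ x, F x => ((t.1, t.2) : X × (Fin V.dim → ℂ))) :=
      continuous_induced_dom
    exact continuous_fst.comp cS
  locally_trivial := by
    let tS : TopologicalSpace (Σ x, F x) := TopologicalSpace.induced
      (fun t => ((t.1, t.2) : X × (Fin V.dim → ℂ))) inferInstance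
    exact hF.locally_trivial ⟨rfl⟩
  act g x := (V.rep g).restrict (hinv g x)
  act_one x e := by
    have : ∀ (y : X) (_ : y = x) (w : F y), (w : Fin V.dim → ℂ) = e →
        (⟨y, w⟩ : Σ x, F x) = ⟨x, e⟩ := by
      rintro _ rfl w hw
      rw [Subtype.ext hw]
    exact this _ (one_smul H x) _ (by simp)
  act_mul g h x e := by
    have : ∀ (y z : X) (_ : y = z) (w : F y) (w' : F z), (w : Fin V.dim → ℂ) = w' →
        (⟨y, w⟩ : Σ x, F x) = ⟨z, w'⟩ := by
      rintro _ _ rfl w w' hw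
      rw [Subtype.ext hw]
    exact this _ _ (mul_smul g h x) _ _ (by simp)
  continuous_act := by
    let tS : TopologicalSpace (Σ x, F x) := TopologicalSpace.induced
      (fun t => ((t.1, t.2) : X × (Fin V.dim → ℂ))) inferInstance
    have cS : Continuous (fun t : Σ x, F x => ((t.1, t.2) : X × (Fin V.dim → ℂ))) :=
      continuous_induced_dom
    refine continuous_induced_rng.2 (Continuous.prodMk ?_ ?_)
    · exact continuous_fst.smul (continuous_fst.comp (cS.comp continuous_snd))
    · exact V.continuous_rep.comp
        (continuous_fst.prodMk (continuous_snd.comp (cS.comp continuous_snd)))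

end GVectorBundle

/-! ### Orthogonal complements and the splitting of the trivial bundle -/

namespace GVectorBundle

variable {H : Type*} [Group H] [TopologicalSpace H]
variable {X : Type u} [TopologicalSpace X] [MulAction H X]
variable {E : GVectorBundle.{u, v} H X} {V : ContFDRep H}

/-- The orthogonal complement of the image of a bundle map with respect to a metric. -/
def orthogonal (Φ : E.RepMap V) (M : X → (Fin V.dim → ℂ) →ₗ⋆[ℂ] (Fin V.dim → ℂ) →ₗ[ℂ] ℂ)
    (x : X) : Submodule ℂ (Fin V.dim → ℂ) :=
  ⨅ e, LinearMap.ker (M x (Φ.toFun x e))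

theorem mem_orthogonal {Φ : E.RepMap V}
    {M : X → (Fin V.dim → ℂ) →ₗ⋆[ℂ] (Fin V.dim → ℂ) →ₗ[ℂ] ℂ} {x : X} {v : Fin V.dim → ℂ} :
    v ∈ orthogonal Φ M x ↔ ∀ e, M x (Φ.toFun x e) v = 0 := by
  simp [orthogonal, Submodule.mem_iInf]

/-- Local description of an injective bundle map and of its adjoint. -/
theorem exists_local_adjoint (Φ : E.RepMap V) (hΦ : ∀ x, Function.Injective (Φ.toFun x))
    {M : X → (Fin V.dim → ℂ) →ₗ⋆[ℂ] (Fin V.dim → ℂ) →ₗ[ℂ] ℂ}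
    (hMc : Continuous fun p : X × (Fin V.dim → ℂ) × (Fin V.dim → ℂ) => M p.1 p.2.1 p.2.2)
    (hM0 : ∀ x v, M x v v = 0 → v = 0) (x₀ : X) :
    ∃ U : Set X, IsOpen U ∧ x₀ ∈ U ∧ ∃ (n : ℕ) (φ : ∀ x : U, E.Fiber x ≃ₗ[ℂ] (Fin n → ℂ))
      (B : X → (Fin n → ℂ) →L[ℂ] (Fin V.dim → ℂ)) (C : X → (Fin V.dim → ℂ) →L[ℂ] (Fin n → ℂ)),
      (Continuous fun q : U × (Fin n → ℂ) => (⟨q.1, (φ q.1).symm q.2⟩ : E.Total)) ∧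
      ContinuousOn B U ∧ ContinuousOn C U ∧
      (∀ (x : U) w, B x w = Φ.toFun x ((φ x).symm w)) ∧
      (∀ x ∈ U, ∀ v, v ∈ orthogonal Φ M x ↔ C x v = 0) ∧
      ∀ x ∈ U, IsUnit ((C x).comp (B x)) := by
  classical
  obtain ⟨U, hU, hxU, n, φ, hφ⟩ := E.locally_trivial x₀
  have hφs := continuous_trivialization_symm hφ
  let B : X → (Fin n → ℂ) →L[ℂ] (Fin V.dim → ℂ) := fun x =>
    if h : x ∈ U then LinearMap.toContinuousLinearMap
      (Φ.toFun x ∘ₗ (φ ⟨x, h⟩).symm.toLinearMap) else 0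
  have hB : ∀ (x : U) w, B x w = Φ.toFun x ((φ x).symm w) := by
    intro x w
    simp [B]
  -- `C x` pairs a vector with the images under `B x` of the standard basis. It plays the role of
  -- the adjoint of `B x`, and its kernel is the orthogonal complement of the image.
  let C : X → (Fin V.dim → ℂ) →L[ℂ] (Fin n → ℂ) := fun x =>
    LinearMap.toContinuousLinearMap (LinearMap.pi fun i => M x (B x (Pi.single i 1)))
  have hC : ∀ x v i, C x v i = M x (B x (Pi.single i 1)) v := fun x v i => rfl
  have hBw : ∀ w, ContinuousOn (fun x => B x w) U := by
    intro w
    rw [continuousOn_iff_continuous_domRestrict]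
    refine (Φ.continuous_toFun.comp (hφs.comp
      (continuous_id.prodMk (continuous_const (y := w))))).congr fun x => ?_
    exact (hB x w).symm
  have hCB : ∀ x v w, C x v = 0 → M x (B x w) v = 0 := by
    intro x v w h
    have h1 : w = ∑ i, w i • (Pi.single i 1 : Fin n → ℂ) := by
      rw [← pi_eq_sum_univ' w]
    rw [h1]
    simp only [map_sum, map_smul, LinearMap.map_smulₛₗ, LinearMap.sum_apply, LinearMap.smul_apply]
    refine Finset.sum_eq_zero fun i _ => ?_
    rw [← hC, h]
    simp
  refine ⟨U, hU, hxU, n, φ, B, C, hφs, continuousOn_clm_apply.2 hBw,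
    continuousOn_clm_apply.2 fun v => continuousOn_pi.2 fun i => ?_, hB, fun x hx v => ?_,
    fun x hx => ?_⟩
  · exact hMc.comp_continuousOn
      (continuousOn_id.prodMk ((hBw (Pi.single i 1)).prodMk continuousOn_const))
  · rw [mem_orthogonal]
    constructor
    · intro h
      funext i
      rw [hC, hB ⟨x, hx⟩]
      exact h _
    · intro h e
      have := hCB x v (φ ⟨x, hx⟩ e) h
      rwa [hB ⟨x, hx⟩, LinearEquiv.symm_apply_apply] at this
  -- If `C B w = 0`, then `B w` is orthogonal to itself, so it vanishes by definiteness, and `w =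
  -- 0`. An injective endomorphism of `ℂⁿ` is invertible.
  · have hinj : Function.Injective ((C x).comp (B x)).toLinearMap := by
      rw [injective_iff_map_eq_zero]
      intro w hw
      have h1 := hM0 x _ (hCB x (B x w) w hw)
      rw [hB ⟨x, hx⟩] at h1
      have h2 := (injective_iff_map_eq_zero _).1 (hΦ x) _ h1
      simpa using h2
    let e := (LinearEquiv.ofInjectiveEndo _ hinj).toContinuousLinearEquiv
    exact ⟨ContinuousLinearEquiv.toUnit e, ContinuousLinearMap.ext fun w => rfl⟩

/-- A bundle with an injective equivariant map to a representation carrying an invariant metric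
is a direct summand of a trivial bundle. -/
theorem exists_complement [ContinuousSMul H X] (Φ : E.RepMap V)
    (hΦ : ∀ x, Function.Injective (Φ.toFun x))
    {M : X → (Fin V.dim → ℂ) →ₗ⋆[ℂ] (Fin V.dim → ℂ) →ₗ[ℂ] ℂ}
    (hMc : Continuous fun p : X × (Fin V.dim → ℂ) × (Fin V.dim → ℂ) => M p.1 p.2.1 p.2.2)
    (hMg : ∀ (g : H) x v w, M (g • x) (V.rep g v) (V.rep g w) = M x v w)
    (hM0 : ∀ x v, M x v v = 0 → v = 0) :
    ∃ F : GVectorBundle.{u, 0} H X, Nonempty ((E.sum F).Iso (trivialBundle X V)) := by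
  have hloc := exists_local_adjoint Φ hΦ hMc hM0
  have hker : IsLocallyKernel (orthogonal Φ M) := by
    intro x₀
    obtain ⟨U, hU, hxU, n, φ, B, C, -, -, hCc, -, hC, hu⟩ := hloc x₀
    refine ⟨U, hU, hxU, n, C, hCc, hC, fun w => ?_⟩
    exact ⟨B x₀ (Ring.inverse ((C x₀).comp (B x₀)) w),
      DFunLike.congr_fun (Ring.mul_inverse_cancel _ (hu x₀ hxU)) w⟩
  have hinv : ∀ (g : H) x, ∀ v ∈ orthogonal Φ M x, V.rep g v ∈ orthogonal Φ M (g • x) := by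
    intro g x v hv
    rw [mem_orthogonal] at hv ⊢
    intro e
    have h1 : ∀ u, V.rep g (V.rep g⁻¹ u) = u := by
      intro u
      rw [← Module.End.mul_apply, ← map_mul]
      simp
    have h2 : ∀ y, y = x → ∀ e : E.Fiber y, M x (Φ.toFun y e) v = 0 := by
      rintro _ rfl
      exact hv
    rw [← h1 (Φ.toFun (g • x) e), hMg, ← Φ.equivariant]
    exact h2 _ (inv_smul_smul g x) _
  let F := kernelBundle V (orthogonal Φ M) hker hinv
  let Ψ : ∀ x, (E.Fiber x × orthogonal Φ M x) →ₗ[ℂ] (Fin V.dim → ℂ) := fun x =>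
    (Φ.toFun x).coprod (orthogonal Φ M x).subtype
  have hΨ : ∀ x e v, Ψ x (e, v) = Φ.toFun x e + v := fun x e v => rfl
  have hinj : ∀ x, Function.Injective (Ψ x) := by
    intro x
    rw [injective_iff_map_eq_zero]
    rintro ⟨e, v⟩ h
    rw [hΨ] at h
    have h1 := mem_orthogonal.1 v.2 e
    rw [eq_neg_of_add_eq_zero_right h, map_neg, neg_eq_zero] at h1
    have h2 := hM0 _ _ h1
    rw [h2, zero_add] at h
    exact Prod.ext ((injective_iff_map_eq_zero _).1 (hΦ x) _ h2) (Subtype.ext h)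
  -- `B (C B)⁻¹ C` is the projection onto the image of `Φ` along the orthogonal complement. This
  -- proves surjectivity of `Ψ` and gives a local formula for its inverse, from which continuity of
  -- the inverse follows.
  have hright : ∀ {x₀ : X} {U : Set X} {n : ℕ} {φ : ∀ x : U, E.Fiber x ≃ₗ[ℂ] (Fin n → ℂ)}
      {B : X → (Fin n → ℂ) →L[ℂ] (Fin V.dim → ℂ)} {C : X → (Fin V.dim → ℂ) →L[ℂ] (Fin n → ℂ)}
      (_ : ∀ (x : U) w, B x w = Φ.toFun x ((φ x).symm w))
      (_ : ∀ x ∈ U, ∀ v, v ∈ orthogonal Φ M x ↔ C x v = 0)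
      (_ : ∀ x ∈ U, IsUnit ((C x).comp (B x))) (hx : x₀ ∈ U) (v : Fin V.dim → ℂ),
      ∃ h : v - B x₀ (Ring.inverse ((C x₀).comp (B x₀)) (C x₀ v)) ∈ orthogonal Φ M x₀,
        Ψ x₀ ((φ ⟨x₀, hx⟩).symm (Ring.inverse ((C x₀).comp (B x₀)) (C x₀ v)), ⟨_, h⟩) = v := by
    intro x₀ U n φ B C hB hC hu hx v
    have h : v - B x₀ (Ring.inverse ((C x₀).comp (B x₀)) (C x₀ v)) ∈ orthogonal Φ M x₀ := by
      rw [hC x₀ hx, map_sub, sub_eq_zero]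
      exact (DFunLike.congr_fun (Ring.mul_inverse_cancel _ (hu x₀ hx)) (C x₀ v)).symm
    refine ⟨h, ?_⟩
    rw [hΨ, ← hB ⟨x₀, hx⟩]
    simp
  have hsurj : ∀ x, Function.Surjective (Ψ x) := by
    intro x v
    obtain ⟨U, hU, hxU, n, φ, B, C, -, -, -, hB, hC, hu⟩ := hloc x
    obtain ⟨h, h'⟩ := hright hB hC hu hxU v
    exact ⟨_, h'⟩
  let Θ : ∀ x, (E.sum F).Fiber x ≃ₗ[ℂ] (trivialBundle X V).Fiber x := fun x =>
    LinearEquiv.ofBijective (Ψ x) ⟨hinj x, hsurj x⟩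
  have cS : Continuous (fun t : (E.sum F).Total =>
      ((⟨t.1, t.2.1⟩, ⟨t.1, t.2.2⟩) : E.Total × F.Total)) := continuous_induced_dom
  have cF : Continuous (fun t : F.Total => ((t.1, t.2.1) : X × (Fin V.dim → ℂ))) :=
    continuous_induced_dom
  have cT : Continuous (fun t : (trivialBundle X V).Total =>
      ((t.1, t.2) : X × (Fin V.dim → ℂ))) := continuous_induced_dom
  refine ⟨F, ⟨⟨Θ, ?_, ?_⟩⟩⟩
  · rw [isHomeomorph_iff_exists_inverse]
    refine ⟨?_, fun t => ⟨t.1, (Θ t.1).symm t.2⟩, fun t => ?_, fun t => ?_, ?_⟩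
    · refine continuous_induced_rng.2 (Continuous.prodMk ?_ ?_)
      · exact (E.sum F).continuous_proj
      · exact (Φ.continuous_toFun.comp (continuous_fst.comp cS)).add
          (continuous_snd.comp (cF.comp (continuous_snd.comp cS)))
    · exact Sigma.ext rfl (heq_of_eq ((Θ t.1).symm_apply_apply t.2))
    · exact Sigma.ext rfl (heq_of_eq ((Θ t.1).apply_symm_apply t.2))
    · rw [continuous_iff_continuousAt]
      intro t₀
      obtain ⟨U, hU, hxU, n, φ, B, C, hφ, hBc, hCc, hB, hC, hu⟩ := hloc t₀.1
      have hopen : IsOpen {t : (trivialBundle X V).Total | t.1 ∈ U} :=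
        hU.preimage (trivialBundle X V).continuous_proj
      refine ContinuousOn.continuousAt (s := {t | t.1 ∈ U}) ?_ (hopen.mem_nhds hxU)
      rw [continuousOn_iff_continuous_domRestrict]
      have c1 : Continuous fun t : {t : (trivialBundle X V).Total // t.1 ∈ U} => t.1.1 :=
        continuous_fst.comp (cT.comp continuous_subtype_val)
      have c2 : Continuous fun t : {t : (trivialBundle X V).Total // t.1 ∈ U} =>
          (t.1.2 : Fin V.dim → ℂ) :=
        continuous_snd.comp (cT.comp continuous_subtype_val)
      have cB := hBc.comp_continuous c1 fun t => t.2
      have cC := hCc.comp_continuous c1 fun t => t.2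
      have ci : ContinuousOn (fun x => Ring.inverse ((C x).comp (B x))) U := by
        intro x hx
        obtain ⟨a, ha⟩ := hu x hx
        have h1 : ContinuousAt Ring.inverse ((C x).comp (B x)) :=
          ha ▸ NormedRing.inverse_continuousAt a
        exact h1.comp_continuousWithinAt (f := fun x => (C x).comp (B x))
          ((hCc.clm_comp hBc) x hx)
      have cw : Continuous fun t : {t : (trivialBundle X V).Total // t.1 ∈ U} =>
          Ring.inverse ((C t.1.1).comp (B t.1.1)) (C t.1.1 t.1.2) :=
        (ci.comp_continuous c1 fun t => t.2).clm_apply (cC.clm_apply c2)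
      have hΘ : ∀ t : {t : (trivialBundle X V).Total // t.1 ∈ U}, (Θ t.1.1).symm t.1.2 =
          ((φ ⟨t.1.1, t.2⟩).symm (Ring.inverse ((C t.1.1).comp (B t.1.1)) (C t.1.1 t.1.2)),
            ⟨_, (hright hB hC hu t.2 t.1.2).1⟩) := by
        intro t
        exact (LinearEquiv.symm_apply_eq _).2 (hright hB hC hu t.2 t.1.2).2.symm
      refine continuous_induced_rng.2 (Continuous.prodMk ?_ (continuous_induced_rng.2
        (Continuous.prodMk c1 ?_)))
      · refine (hφ.comp ((c1.subtype_mk fun t => t.2).prodMk cw)).congr fun t => ?_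
        exact Sigma.ext rfl (heq_of_eq (congrArg Prod.fst (hΘ t)).symm)
      · refine (c2.sub (cB.clm_apply cw)).congr fun t => ?_
        exact (congrArg
          (fun p : E.Fiber t.1.1 × orthogonal Φ M t.1.1 => (p.2 : Fin V.dim → ℂ)) (hΘ t)).symm
  · intro g x t
    obtain ⟨e, v⟩ : E.Fiber x × orthogonal Φ M x := t
    change Φ.toFun (g • x) (E.act g x e) + V.rep g v = V.rep g (Φ.toFun x e + v)
    rw [Φ.equivariant, map_add]

end GVectorBundle

/-- A topological group with enough representative functions satisfies (AN). -/
theorem satisfiesAN_of_representativeFunctions {H : Type*} [Group H] [TopologicalSpace H]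
    [IsTopologicalGroup H]
    (hR : ∀ x y : H, x ≠ y → ∃ f ∈ representativeFunctions H, f x ≠ f y) :
    SatisfiesAN.{u, v} H := by
  intro X _ _ _ _ _ _ E
  -- An empty `X` says nothing about local compactness of `H`, so no Haar measure is at hand; the
  -- zero representation serves instead.
  rcases isEmpty_or_nonempty X with hX | hX
  · let V : ContFDRep H := ⟨0, 1, by simpa using continuous_snd⟩
    let F := GVectorBundle.trivialBundle X V
    have : IsEmpty (E.sum F).Total := ⟨fun t => hX.elim t.1⟩
    have : IsEmpty F.Total := ⟨fun t => hX.elim t.1⟩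
    exact ⟨V, F, ⟨⟨fun x => hX.elim x,
      isHomeomorph_iff_exists_inverse.2 ⟨continuous_of_const fun t => isEmptyElim t,
        isEmptyElim, isEmptyElim, isEmptyElim, continuous_of_const fun t => isEmptyElim t⟩,
      fun _ x => hX.elim x⟩⟩⟩
  · have : LocallyCompactSpace H := locallyCompactSpace_of_properSMul (X := X)
    obtain ⟨V, Φ, hΦ⟩ := GVectorBundle.exists_repMap_injective E
      (GVectorBundle.exists_repMap_ne_zero hR E)
    obtain ⟨M, hMc, hMg, hM0⟩ := exists_invariant_metric (X := X) V
    exact ⟨V, GVectorBundle.exists_complement Φ hΦ hMc hMg hM0⟩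

/-! ### Separation of points on `ρ.tildeG` and the conclusion for `ρ.tildeQ` -/

namespace IrrUnitaryRep

variable {G : Type*} [Group G] [TopologicalSpace G] [IsTopologicalGroup G]
variable {V : Type*} [NormedAddCommGroup V] [InnerProductSpace ℂ V] [CompleteSpace V]
  [FiniteDimensional ℂ V]
variable {A : Subgroup G} [A.Normal] (ρ : IrrUnitaryRep A V)

theorem continuous_iotaRho : Continuous ρ.iotaRho :=
  Continuous.subtype_mk ((continuous_subtype_val.subtype_mk _).prodMk ρ.continuous_hom) _

theorem isCompact_iotaRho_range (hA : IsCompact (A : Set G)) :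
    IsCompact (ρ.iotaRho.range : Set ρ.tildeG) := by
  have : CompactSpace A := isCompact_iff_compactSpace.1 hA
  rw [MonoidHom.coe_range]
  exact isCompact_range ρ.continuous_iotaRho

/-- The representative functions of `G̃_[ρ]` separate points if `G` is linear. -/
theorem representativeFunctions_separate_tildeG (hG : IsLinearGroup G) (x y : ρ.tildeG)
    (hxy : x ≠ y) : ∃ f ∈ representativeFunctions ρ.tildeG, f x ≠ f y := by
  obtain ⟨n, f, hf⟩ := hG
  let b := Module.finBasis ℂ V
  -- An element of `ρ.tildeG` is a pair. `M₁`, the complexified linear embedding of `G`, determines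
  -- its first component, and `M₂`, the matrix of the unitary, its second.
  let M₁ : ρ.tildeG → Matrix (Fin n) (Fin n) ℂ := fun z =>
    ((f z.1.1 : GL (Fin n) ℝ) : Matrix (Fin n) (Fin n) ℝ).map Complex.ofRealHom
  let M₂ : ρ.tildeG → Matrix (Fin (Module.finrank ℂ V)) (Fin (Module.finrank ℂ V)) ℂ := fun z =>
    LinearMap.toMatrix b b ((z.1.2 : V →L[ℂ] V) : V →ₗ[ℂ] V)
  have hM₁ : ∀ g h, M₁ (g * h) = M₁ g * M₁ h := fun g h => by
    simp only [M₁, ← Matrix.map_mul]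
    simp
  have hM₂ : ∀ g h, M₂ (g * h) = M₂ g * M₂ h := fun g h => by
    simp only [M₂, ← LinearMap.toMatrix_mul]
    rfl
  have c₁ : Continuous M₁ := by
    have : Continuous fun z : ρ.tildeG => ((f z.1.1 : GL (Fin n) ℝ) : Matrix (Fin n) (Fin n) ℝ) :=
      Units.continuous_val.comp (hf.continuous.comp (continuous_subtype_val.comp
        (continuous_fst.comp continuous_subtype_val)))
    exact this.matrix_map Complex.continuous_ofReal
  have c₂ : Continuous M₂ := by
    refine continuous_matrix fun i j => ?_
    have h1 : Continuous fun z : ρ.tildeG => (z.1.2 : V →L[ℂ] V) (b j) :=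
      (continuous_subtype_val.comp (continuous_snd.comp continuous_subtype_val)).clm_apply
        continuous_const
    have h2 : Continuous (b.coord i) := LinearMap.continuous_of_finiteDimensional _
    refine (h2.comp h1).congr fun z => ?_
    simp [M₂, LinearMap.toMatrix_apply]
  by_contra! hsep
  have e₁ : M₁ x = M₁ y := Matrix.ext fun i j =>
    hsep _ (isRepresentative_entry M₁ hM₁ c₁ i j)
  have e₂ : M₂ x = M₂ y := Matrix.ext fun i j =>
    hsep _ (isRepresentative_entry M₂ hM₂ c₂ i j)
  apply hxy
  refine Subtype.ext (Prod.ext (Subtype.ext (hf.injective (Units.ext ?_))) (Subtype.ext ?_))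
  · exact Matrix.map_injective Complex.ofReal_injective e₁
  · exact ContinuousLinearMap.coe_injective ((LinearMap.toMatrix b b).injective e₂)

end IrrUnitaryRep

theorem mainTheorem9 {G : Type*} [Group G] [TopologicalSpace G] [IsTopologicalGroup G]
    (hG : IsLinearGroup G)
    (A : Subgroup G) [A.Normal] (hA : IsCompact (A : Set G))
    {V : Type*} [NormedAddCommGroup V] [InnerProductSpace ℂ V] [CompleteSpace V]
    [FiniteDimensional ℂ V] (ρ : IrrUnitaryRep A V) :
    SatisfiesAN.{u, v} ρ.tildeQ := by
  -- Hausdorffness passes to `ρ.tildeG`, where the compact cosets of the image of `A` have to be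
  -- closed.
  have : T2Space G := by
    obtain ⟨n, f, hf⟩ := hG
    exact hf.isEmbedding.t2Space
  exact satisfiesAN_of_representativeFunctions
    (representativeFunctions_separate_quotient _ (ρ.isCompact_iotaRho_range hA)
      (ρ.representativeFunctions_separate_tildeG hG))
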